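/- Let $l_1,l_2,\kappa,\rho,\mu,\alpha_1,\beta,\gamma,\xi_1,\xi_2>0$ and $\alpha:=\alpha_1+\gamma^2\beta$. Let $\mathrm H=L^2(0,l_1)\times[L^2(0,l_2)]^4$ (complex-valued functions), with elements $X=(\zeta,u_1,u_2,w_1,w_2)$, where $\zeta(x)=z(-x)$ is the reflected temperature $z$ of the rod $(-l_1,0)$, equipped with the energy inner product $$\langle X,\tilde X\rangle_{\mathrm H}=\tfrac12\int_0^{l_1}\zeta\,\overline{\tilde\zeta}\,dx+\tfrac12\int_0^{l_2}\Big[\rho\,w_1\overline{\tilde w_1}+\mu\,w_2\overline{\tilde w_2}+\alpha_1u_1\overline{\tilde u_1}+\beta(\gamma u_1-u_2)\overline{(\gamma\tilde u_1-\tilde u_2)}\Big]dx .$$ Let $\mathcal A$ be the closed-loop heat--piezoelectric beam operator $$\mathcal A(\zeta,u_1,u_2,w_1,w_2)=\Big(\kappa\zeta'',\;w_1',\;w_2',\;\tfrac1\rho(\alpha u_1'-\gamma\beta u_2'),\;\tfrac1\mu(\beta u_2'-\gamma\beta u_1')\Big)$$ whose domain $\mathrm{Dom}(\mathcal A)$ is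 the set of all $X\in\mathrm H$ with $\zeta\in H^2(0,l_1)$, $u_1,u_2,w_1,w_2\in H^1(0,l_2)$ and $$\zeta(l_1)=0,\quad w_1(0)=\zeta(0),\quad w_2(0)=0,\quad \alpha u_1(0)-\gamma\beta u_2(0)=-\kappa\zeta'(0),$$ $$\alpha u_1(l_2)-\gamma\beta u_2(l_2)=-\xi_1w_1(l_2),\qquad \beta u_2(l_2)-\gamma\beta u_1(l_2)=-\xi_2w_2(l_2).$$ Then $(\mathcal A,\mathrm{Dom}(\mathcal A))$ is the infinitesimal generator of a $C_0$-semigroup $(T(t))_{t\ge0}$ on $\mathrm H$. In particular the closed-loop system is well posed: for every $X_0\in\mathrm{Dom}(\mathcal A)$, $X(t)=T(t)X_0$ is the unique classical solution of $\dot X=\mathcal AX$ on $[0,\infty)$ with $X(0)=X_0$, that is, the unique continuously differentiable $X:[0,\infty)\to\mathrm H$ with values in $\mathrm{Dom}(\mathcal A)$ that satisfies it. -/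

import Mathlib

open MeasureTheory Set Filter Topology
open scoped ContDiff NNReal

/-! ### Strongly continuous semigroups and their generators -/

/-- A `C₀`-semigroup of bounded operators on a complex normed space. -/
structure C0Semigroup (X : Type*) [NormedAddCommGroup X] [NormedSpace ℂ X] where
  /-- the operator at time `t ≥ 0` -/
  toFun : ℝ≥0 → X →L[ℂ] X
  map_zero : toFun 0 = ContinuousLinearMap.id ℂ X
  map_add : ∀ s t : ℝ≥0, toFun (s + t) = (toFun s).comp (toFun t)
  strongly_continuous : ∀ x : X, Continuous fun t : ℝ≥0 => toFun t x

namespace C0Semigroup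

/-- The graph of the infinitesimal generator: all `(x, y)` with
`(T(h) x - x) / h → y` as `h → 0+`. -/
def generatorGraph {X : Type*} [NormedAddCommGroup X] [NormedSpace ℂ X]
    (T : C0Semigroup X) : Submodule ℂ (X × X) where
  carrier := {q | Tendsto (fun h : ℝ≥0 => (h : ℝ)⁻¹ • (T.toFun h q.1 - q.1)) (𝓝[>] 0) (𝓝 q.2)}
  add_mem' := by
    intro a b ha hb
    refine (Tendsto.add ha hb).congr fun h => ?_
    simp only [Prod.fst_add, _root_.map_add, ← smul_add]
    congr 1
    abel
  zero_mem' := by simp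
  smul_mem' := by
    intro c a ha
    refine (Tendsto.const_smul ha c).congr fun h => ?_
    simp only [Prod.smul_fst, map_smul, ← smul_sub]
    rw [smul_comm]

/-- The graph of the generator is single-valued. -/
theorem generatorGraph_functional {X : Type*} [NormedAddCommGroup X] [NormedSpace ℂ X]
    (T : C0Semigroup X) (q : X × X) (hq : q ∈ T.generatorGraph) (h0 : q.1 = 0) : q.2 = 0 := by
  have h1 : Tendsto (fun h : ℝ≥0 => (h : ℝ)⁻¹ • (T.toFun h q.1 - q.1)) (𝓝[>] 0) (𝓝 q.2) := hq
  simp only [h0, _root_.map_zero, sub_zero, smul_zero] at h1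
  exact tendsto_nhds_unique h1 tendsto_const_nhds

/-- The infinitesimal generator, as an unbounded operator with its natural domain. -/
noncomputable def generator {X : Type*} [NormedAddCommGroup X] [NormedSpace ℂ X]
    (T : C0Semigroup X) : X →ₗ.[ℂ] X :=
  T.generatorGraph.toLinearPMap

theorem mem_generator_graph {X : Type*} [NormedAddCommGroup X] [NormedSpace ℂ X]
    (T : C0Semigroup X) (x y : X) : (x, y) ∈ T.generator.graph ↔
      Tendsto (fun h : ℝ≥0 => (h : ℝ)⁻¹ • (T.toFun h x - x)) (𝓝[>] 0) (𝓝 y) := by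
  rw [generator, Submodule.toLinearPMap_graph_eq _ T.generatorGraph_functional]
  rfl

end C0Semigroup

/-- `u : [0, ∞) → X` is a classical solution of `u' = A u`, `u(0) = x₀`: it is continuously
differentiable on `[0, ∞)`, stays in the domain of `A` and satisfies the equation.
The values of `u` at negative times play no role. -/
structure IsClassicalSolution {X : Type*} [NormedAddCommGroup X] [NormedSpace ℂ X]
    (A : X →ₗ.[ℂ] X) (x₀ : X) (u : ℝ → X) : Prop where
  initial : u 0 = x₀
  contDiffOn : ContDiffOn ℝ 1 u (Ici 0)
  equation : ∀ t : ℝ, 0 ≤ t → ∃ h : u t ∈ A.domain,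
    HasDerivWithinAt u (A ⟨u t, h⟩) (Ici 0) t

/-! ### `L²`, weak derivatives and boundary values on an interval -/

/-- The complex space `L²(0, l)`. -/
abbrev L2 (l : ℝ) : Type := Lp ℂ 2 (volume.restrict (Ioo (0 : ℝ) l))

/-- `g ∈ L²(0, l)` is the weak derivative of `u ∈ L²(0, l)`. Thus `u ∈ H¹(0, l)` means that
such a `g` exists, and `u ∈ H²(0, l)` that in addition `g` has a weak derivative in `L²(0, l)`. -/
def IsWeakDeriv {l : ℝ} (u g : L2 l) : Prop :=
  ∀ φ : ℝ → ℝ, ContDiff ℝ ∞ φ → HasCompactSupport φ → tsupport φ ⊆ Ioo 0 l →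
    ∫ x in Ioo 0 l, deriv φ x • u x = - ∫ x in Ioo 0 l, φ x • g x

/-- `f` is a representative of `u` that is continuous on `[0, l]`. Such a representative is unique
on `[0, l]` if `0 < l`, and it exists for `u ∈ H¹(0, l)`; its values at `0` and `l` are the boundary
values of `u`. -/
def IsContRep {l : ℝ} (u : L2 l) (f : ℝ → ℂ) : Prop :=
  ContinuousOn f (Icc 0 l) ∧ u =ᵐ[volume.restrict (Ioo (0 : ℝ) l)] f

theorem integrable_smul_L2 {l : ℝ} {φ : ℝ → ℝ} (hφ : Continuous φ) (hc : HasCompactSupport φ)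
    (u : L2 l) : Integrable (fun x => φ x • u x) (volume.restrict (Ioo (0 : ℝ) l)) := by
  obtain ⟨C, hC⟩ := hφ.bounded_above_of_compact_support hc
  have hu : Integrable u (volume.restrict (Ioo (0 : ℝ) l)) :=
    (Lp.memLp u).integrable (by norm_num)
  exact hu.bdd_smul C hφ.aestronglyMeasurable (Eventually.of_forall hC)

theorem IsWeakDeriv.add {l : ℝ} {u g v k : L2 l} (hu : IsWeakDeriv u g) (hv : IsWeakDeriv v k) :
    IsWeakDeriv (u + v) (g + k) := by
  intro φ h1 h2 h3
  have d1 : Continuous (deriv φ) := h1.continuous_deriv (by simp)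
  have e1 : ∫ x in Ioo 0 l, deriv φ x • (u + v) x
      = ∫ x in Ioo 0 l, (deriv φ x • u x + deriv φ x • v x) := by
    refine integral_congr_ae ?_
    filter_upwards [Lp.coeFn_add u v] with x hx
    rw [hx, Pi.add_apply, smul_add]
  have e2 : ∫ x in Ioo 0 l, φ x • (g + k) x = ∫ x in Ioo 0 l, (φ x • g x + φ x • k x) := by
    refine integral_congr_ae ?_
    filter_upwards [Lp.coeFn_add g k] with x hx
    rw [hx, Pi.add_apply, smul_add]
  rw [e1, e2, integral_add (integrable_smul_L2 d1 h2.deriv u) (integrable_smul_L2 d1 h2.deriv v),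
    integral_add (integrable_smul_L2 h1.continuous h2 g) (integrable_smul_L2 h1.continuous h2 k),
    hu φ h1 h2 h3, hv φ h1 h2 h3, neg_add]

theorem IsWeakDeriv.smul {l : ℝ} {u g : L2 l} (c : ℂ) (hu : IsWeakDeriv u g) :
    IsWeakDeriv (c • u) (c • g) := by
  intro φ h1 h2 h3
  have e1 : ∫ x in Ioo 0 l, deriv φ x • (c • u) x = ∫ x in Ioo 0 l, c • (deriv φ x • u x) := by
    refine integral_congr_ae ?_
    filter_upwards [Lp.coeFn_smul c u] with x hx
    rw [hx, Pi.smul_apply, smul_comm]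
  have e2 : ∫ x in Ioo 0 l, φ x • (c • g) x = ∫ x in Ioo 0 l, c • (φ x • g x) := by
    refine integral_congr_ae ?_
    filter_upwards [Lp.coeFn_smul c g] with x hx
    rw [hx, Pi.smul_apply, smul_comm]
  rw [e1, e2, integral_smul, integral_smul, hu φ h1 h2 h3, smul_neg]

theorem isWeakDeriv_zero {l : ℝ} : IsWeakDeriv (0 : L2 l) 0 := by
  intro φ _ _ _
  have e : ∀ ψ : ℝ → ℝ, ∫ x in Ioo 0 l, ψ x • (0 : L2 l) x = 0 := by
    intro ψ
    refine integral_eq_zero_of_ae ?_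
    filter_upwards [Lp.coeFn_zero ℂ 2 (volume.restrict (Ioo (0 : ℝ) l))] with x hx
    rw [hx, Pi.zero_apply, smul_zero]
  rw [e, e, neg_zero]

/-- The weak derivative is unique. -/
theorem IsWeakDeriv.eq_zero {l : ℝ} {g : L2 l} (h : IsWeakDeriv 0 g) : g = 0 := by
  have hg : Integrable g (volume.restrict (Ioo (0 : ℝ) l)) :=
    (Lp.memLp g).integrable (by norm_num)
  have hloc : LocallyIntegrableOn g (Ioo 0 l) volume := IntegrableOn.locallyIntegrableOn hg
  have key := isOpen_Ioo.ae_eq_zero_of_integral_contDiff_smul_eq_zero (μ := volume) hloc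
    (fun φ h1 h2 h3 => by
      have e := h φ h1 h2 h3
      have e0 : ∫ x in Ioo 0 l, deriv φ x • (0 : L2 l) x = 0 := by
        refine integral_eq_zero_of_ae ?_
        filter_upwards [Lp.coeFn_zero ℂ 2 (volume.restrict (Ioo (0 : ℝ) l))] with x hx
        rw [hx, Pi.zero_apply, smul_zero]
      rw [e0] at e
      have e3 : ∫ x in Ioo 0 l, φ x • g x = ∫ x, φ x • g x := by
        refine setIntegral_eq_integral_of_forall_compl_eq_zero fun x hx => ?_
        rw [image_eq_zero_of_notMem_tsupport (fun hh => hx (h3 hh)), zero_smul]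
      rw [← e3]
      exact neg_eq_zero.mp e.symm)
  rw [Lp.eq_zero_iff_ae_eq_zero]
  exact (ae_restrict_iff' measurableSet_Ioo).mpr key

theorem IsContRep.add {l : ℝ} {u v : L2 l} {f g : ℝ → ℂ} (hu : IsContRep u f)
    (hv : IsContRep v g) : IsContRep (u + v) (f + g) :=
  ⟨hu.1.add hv.1, (Lp.coeFn_add u v).trans (hu.2.add hv.2)⟩

theorem IsContRep.smul {l : ℝ} {u : L2 l} {f : ℝ → ℂ} (c : ℂ) (hu : IsContRep u f) :
    IsContRep (c • u) (c • f) :=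
  ⟨hu.1.const_smul c, (Lp.coeFn_smul c u).trans (hu.2.const_smul c)⟩

theorem isContRep_zero {l : ℝ} : IsContRep (0 : L2 l) 0 :=
  ⟨continuousOn_const, Lp.coeFn_zero ℂ 2 _⟩

/-! ### The heat-piezoelectric beam system with static feedback -/

/-- The physical constants of the system and the feedback gains `ξ₁`, `ξ₂`; all are positive. -/
structure BeamParams where
  /-- length of the heat-conducting rod -/
  l₁ : ℝ
  /-- length of the piezoelectric beam -/
  l₂ : ℝ
  /-- thermal diffusivity -/
  κ : ℝ
  /-- mass density -/
  ρ : ℝ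
  /-- magnetic permeability -/
  μ : ℝ
  /-- elastic stiffness -/
  α₁ : ℝ
  /-- impermeability coefficient -/
  β : ℝ
  /-- piezoelectric constant -/
  γ : ℝ
  /-- gain of the strain controller -/
  ξ₁ : ℝ
  /-- gain of the voltage controller -/
  ξ₂ : ℝ
  l₁_pos : 0 < l₁
  l₂_pos : 0 < l₂
  κ_pos : 0 < κ
  ρ_pos : 0 < ρ
  μ_pos : 0 < μ
  α₁_pos : 0 < α₁
  β_pos : 0 < β
  γ_pos : 0 < γ
  ξ₁_pos : 0 < ξ₁
  ξ₂_pos : 0 < ξ₂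

/-- The stiffness coefficient `α = α₁ + γ² β`. -/
def BeamParams.α (p : BeamParams) : ℝ := p.α₁ + p.γ ^ 2 * p.β

/-- The energy space `H = L²(0, l₁) × L²(0, l₂)⁴`. A state is `(z, u₁, u₂, w₁, w₂)`, where the
first component is the temperature of the rod `(-l₁, 0)` in the reflected variable:
`z x` is the temperature at the point `-x`, `0 < x < l₁`. -/
def EnergySpace (p : BeamParams) : Type :=
  L2 p.l₁ × L2 p.l₂ × L2 p.l₂ × L2 p.l₂ × L2 p.l₂

namespace EnergySpace

noncomputable instance (p : BeamParams) : AddCommGroup (EnergySpace p) :=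
  inferInstanceAs (AddCommGroup (L2 p.l₁ × L2 p.l₂ × L2 p.l₂ × L2 p.l₂ × L2 p.l₂))

noncomputable instance (p : BeamParams) : Module ℂ (EnergySpace p) :=
  inferInstanceAs (Module ℂ (L2 p.l₁ × L2 p.l₂ × L2 p.l₂ × L2 p.l₂ × L2 p.l₂))

/-- reflected temperature -/
def z {p : BeamParams} (X : EnergySpace p) : L2 p.l₁ := X.1
/-- mechanical strain `v_x` -/
def u₁ {p : BeamParams} (X : EnergySpace p) : L2 p.l₂ := X.2.1
/-- charge gradient `p_x` -/
def u₂ {p : BeamParams} (X : EnergySpace p) : L2 p.l₂ := X.2.2.1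
/-- mechanical velocity `v_t` -/
def w₁ {p : BeamParams} (X : EnergySpace p) : L2 p.l₂ := X.2.2.2.1
/-- current `p_t` -/
def w₂ {p : BeamParams} (X : EnergySpace p) : L2 p.l₂ := X.2.2.2.2

@[simp] theorem add_z {p : BeamParams} (X Y : EnergySpace p) : (X + Y).z = X.z + Y.z := rfl
@[simp] theorem add_u₁ {p : BeamParams} (X Y : EnergySpace p) : (X + Y).u₁ = X.u₁ + Y.u₁ := rfl
@[simp] theorem add_u₂ {p : BeamParams} (X Y : EnergySpace p) : (X + Y).u₂ = X.u₂ + Y.u₂ := rfl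
@[simp] theorem add_w₁ {p : BeamParams} (X Y : EnergySpace p) : (X + Y).w₁ = X.w₁ + Y.w₁ := rfl
@[simp] theorem add_w₂ {p : BeamParams} (X Y : EnergySpace p) : (X + Y).w₂ = X.w₂ + Y.w₂ := rfl
@[simp] theorem smul_z {p : BeamParams} (c : ℂ) (X : EnergySpace p) : (c • X).z = c • X.z := rfl
@[simp] theorem smul_u₁ {p : BeamParams} (c : ℂ) (X : EnergySpace p) : (c • X).u₁ = c • X.u₁ := rfl
@[simp] theorem smul_u₂ {p : BeamParams} (c : ℂ) (X : EnergySpace p) : (c • X).u₂ = c • X.u₂ := rfl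
@[simp] theorem smul_w₁ {p : BeamParams} (c : ℂ) (X : EnergySpace p) : (c • X).w₁ = c • X.w₁ := rfl
@[simp] theorem smul_w₂ {p : BeamParams} (c : ℂ) (X : EnergySpace p) : (c • X).w₂ = c • X.w₂ := rfl
@[simp] theorem zero_z {p : BeamParams} : (0 : EnergySpace p).z = 0 := rfl
@[simp] theorem zero_u₁ {p : BeamParams} : (0 : EnergySpace p).u₁ = 0 := rfl
@[simp] theorem zero_u₂ {p : BeamParams} : (0 : EnergySpace p).u₂ = 0 := rfl
@[simp] theorem zero_w₁ {p : BeamParams} : (0 : EnergySpace p).w₁ = 0 := rfl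
@[simp] theorem zero_w₂ {p : BeamParams} : (0 : EnergySpace p).w₂ = 0 := rfl

theorem ext' {p : BeamParams} {X Y : EnergySpace p} (hz : X.z = Y.z) (hu₁ : X.u₁ = Y.u₁)
    (hu₂ : X.u₂ = Y.u₂) (hw₁ : X.w₁ = Y.w₁) (hw₂ : X.w₂ = Y.w₂) : X = Y :=
  Prod.ext hz (Prod.ext hu₁ (Prod.ext hu₂ (Prod.ext hw₁ hw₂)))

/-- The energy form
`½ ∫₀^{l₁} z z̃ + ½ ∫₀^{l₂} (ρ w₁ w̃₁ + μ w₂ w̃₂ + α₁ u₁ ũ₁ + β (γ u₁ - u₂) (γ ũ₁ - ũ₂))`,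
one factor in each product being conjugated (in Mathlib the one from the first argument). -/
noncomputable def energyForm {p : BeamParams} (X Y : EnergySpace p) : ℂ :=
  (1 / 2 : ℂ) * inner ℂ X.z Y.z
    + (1 / 2 : ℂ) * ((p.ρ : ℂ) * inner ℂ X.w₁ Y.w₁ + (p.μ : ℂ) * inner ℂ X.w₂ Y.w₂
      + (p.α₁ : ℂ) * inner ℂ X.u₁ Y.u₁
      + (p.β : ℂ) * inner ℂ ((p.γ : ℂ) • X.u₁ - X.u₂) ((p.γ : ℂ) • Y.u₁ - Y.u₂))

theorem energyForm_self {p : BeamParams} (X : EnergySpace p) : energyForm X X =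
    (((1 / 2) * ‖X.z‖ ^ 2 + (1 / 2) * (p.ρ * ‖X.w₁‖ ^ 2 + p.μ * ‖X.w₂‖ ^ 2 + p.α₁ * ‖X.u₁‖ ^ 2
      + p.β * ‖(p.γ : ℂ) • X.u₁ - X.u₂‖ ^ 2) : ℝ) : ℂ) := by
  simp only [energyForm, inner_self_eq_norm_sq_to_K]
  push_cast
  rfl

/-- The energy form is an inner product on `H`. -/
@[reducible] noncomputable def core (p : BeamParams) : InnerProductSpace.Core ℂ (EnergySpace p) where
  inner X Y := energyForm X Y
  conj_inner_symm X Y := by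
    simp only [energyForm, map_add, map_mul, inner_conj_symm, Complex.conj_ofReal, map_div₀,
      map_one, map_ofNat]
  re_inner_nonneg X := by
    have h1 := p.ρ_pos
    have h2 := p.μ_pos
    have h3 := p.α₁_pos
    have h4 := p.β_pos
    rw [energyForm_self]
    simp only [RCLike.re_to_complex, Complex.ofReal_re]
    positivity
  add_left X Y Z := by
    have e : (p.γ : ℂ) • (X.u₁ + Y.u₁) - (X.u₂ + Y.u₂)
        = ((p.γ : ℂ) • X.u₁ - X.u₂) + ((p.γ : ℂ) • Y.u₁ - Y.u₂) := by
      rw [smul_add]; abel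
    simp only [energyForm, add_z, add_u₁, add_u₂, add_w₁, add_w₂, e, inner_add_left]
    ring
  smul_left X Y c := by
    have e : (p.γ : ℂ) • (c • X.u₁) - c • X.u₂ = c • ((p.γ : ℂ) • X.u₁ - X.u₂) := by
      rw [smul_sub, smul_comm]
    simp only [energyForm, smul_z, smul_u₁, smul_u₂, smul_w₁, smul_w₂, e, inner_smul_left]
    ring
  definite X h := by
    have h1 := p.ρ_pos
    have h2 := p.μ_pos
    have h3 := p.α₁_pos
    have h4 := p.β_pos
    rw [energyForm_self, Complex.ofReal_eq_zero] at h
    have a1 : 0 ≤ ‖X.z‖ ^ 2 := by positivity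
    have a2 : 0 ≤ p.ρ * ‖X.w₁‖ ^ 2 := by positivity
    have a3 : 0 ≤ p.μ * ‖X.w₂‖ ^ 2 := by positivity
    have a4 : 0 ≤ p.α₁ * ‖X.u₁‖ ^ 2 := by positivity
    have a5 : 0 ≤ p.β * ‖(p.γ : ℂ) • X.u₁ - X.u₂‖ ^ 2 := by positivity
    have b1 : X.z = 0 := by
      have : ‖X.z‖ ^ 2 = 0 := by linarith
      simpa using this
    have b2 : X.w₁ = 0 := by
      have : p.ρ * ‖X.w₁‖ ^ 2 = 0 := by linarith
      simpa [h1.ne'] using this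
    have b3 : X.w₂ = 0 := by
      have : p.μ * ‖X.w₂‖ ^ 2 = 0 := by linarith
      simpa [h2.ne'] using this
    have b4 : X.u₁ = 0 := by
      have : p.α₁ * ‖X.u₁‖ ^ 2 = 0 := by linarith
      simpa [h3.ne'] using this
    have b5 : X.u₂ = 0 := by
      have : p.β * ‖(p.γ : ℂ) • X.u₁ - X.u₂‖ ^ 2 = 0 := by linarith
      simpa [h4.ne', b4] using this
    exact ext' b1 b4 b5 b2 b3

noncomputable instance (p : BeamParams) : NormedAddCommGroup (EnergySpace p) :=
  @InnerProductSpace.Core.toNormedAddCommGroup ℂ (EnergySpace p) _ _ _ (core p)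

noncomputable instance (p : BeamParams) : InnerProductSpace ℂ (EnergySpace p) :=
  InnerProductSpace.ofCore (core p).toCore

end EnergySpace

/-- The transmission and feedback boundary conditions, for continuous functions: `z` and `dz` are
the reflected temperature and its derivative on `[0, l₁]` (so the temperature gradient at the joint
is `-dz 0`), and `u₁, u₂, w₁, w₂` live on `[0, l₂]`. -/
structure BoundaryConditions (p : BeamParams) (z dz u₁ u₂ w₁ w₂ : ℝ → ℂ) : Prop where
  /-- zero temperature at the clamped end of the rod -/
  temperature : z p.l₁ = 0
  /-- continuity of heat and velocity at the joint -/
  joint_value : w₁ 0 = z 0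
  /-- continuity of heat flux and stress at the joint -/
  joint_flux : (p.α : ℂ) * u₁ 0 - (p.γ * p.β : ℂ) * u₂ 0 = (p.κ : ℂ) * -dz 0
  /-- no current at the joint -/
  joint_current : w₂ 0 = 0
  /-- strain feedback at the tip -/
  tip_strain : (p.α : ℂ) * u₁ p.l₂ - (p.γ * p.β : ℂ) * u₂ p.l₂ = -(p.ξ₁ : ℂ) * w₁ p.l₂
  /-- voltage feedback at the tip -/
  tip_voltage : (p.β : ℂ) * u₂ p.l₂ - (p.γ * p.β : ℂ) * u₁ p.l₂ = -(p.ξ₂ : ℂ) * w₂ p.l₂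

/-- `BeamRel p X Y`: the state `X` belongs to the domain of the closed-loop operator, that is
`z ∈ H²(0, l₁)`, `u₁, u₂, w₁, w₂ ∈ H¹(0, l₂)` and the boundary conditions hold, and the operator
maps `X` to `Y`. -/
def BeamRel (p : BeamParams) (X Y : EnergySpace p) : Prop :=
  ∃ (dz ddz : L2 p.l₁) (du₁ du₂ dw₁ dw₂ : L2 p.l₂),
    (IsWeakDeriv X.z dz ∧ IsWeakDeriv dz ddz ∧ IsWeakDeriv X.u₁ du₁ ∧ IsWeakDeriv X.u₂ du₂ ∧
      IsWeakDeriv X.w₁ dw₁ ∧ IsWeakDeriv X.w₂ dw₂) ∧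
    (∃ fz fdz fu₁ fu₂ fw₁ fw₂ : ℝ → ℂ,
      IsContRep X.z fz ∧ IsContRep dz fdz ∧ IsContRep X.u₁ fu₁ ∧ IsContRep X.u₂ fu₂ ∧
      IsContRep X.w₁ fw₁ ∧ IsContRep X.w₂ fw₂ ∧
      BoundaryConditions p fz fdz fu₁ fu₂ fw₁ fw₂) ∧
    Y.z = (p.κ : ℂ) • ddz ∧
    Y.u₁ = dw₁ ∧
    Y.u₂ = dw₂ ∧
    Y.w₁ = (p.ρ : ℂ)⁻¹ • ((p.α : ℂ) • du₁ - (p.γ * p.β : ℂ) • du₂) ∧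
    Y.w₂ = (p.μ : ℂ)⁻¹ • ((p.β : ℂ) • du₂ - (p.γ * p.β : ℂ) • du₁)

/-- The graph of the closed-loop operator. -/
def beamGraph (p : BeamParams) : Submodule ℂ (EnergySpace p × EnergySpace p) where
  carrier := {q | BeamRel p q.1 q.2}
  add_mem' := by
    rintro ⟨X, Y⟩ ⟨X', Y'⟩
      ⟨a, b, c, d, e, f, ⟨h1, h2, h3, h4, h5, h6⟩,
        ⟨f1, f2, f3, f4, f5, f6, r1, r2, r3, r4, r5, r6, bc⟩, y1, y2, y3, y4, y5⟩
      ⟨a', b', c', d', e', f', ⟨h1', h2', h3', h4', h5', h6'⟩,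
        ⟨f1', f2', f3', f4', f5', f6', r1', r2', r3', r4', r5', r6', bc'⟩, y1', y2', y3', y4', y5'⟩
    refine ⟨a + a', b + b', c + c', d + d', e + e', f + f',
      ⟨h1.add h1', h2.add h2', h3.add h3', h4.add h4', h5.add h5', h6.add h6'⟩,
      ⟨f1 + f1', f2 + f2', f3 + f3', f4 + f4', f5 + f5', f6 + f6', r1.add r1', r2.add r2',
        r3.add r3', r4.add r4', r5.add r5', r6.add r6', ?_⟩, ?_, ?_, ?_, ?_, ?_⟩
    · obtain ⟨k1, k2, k3, k4, k5, k6⟩ := bc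
      obtain ⟨k1', k2', k3', k4', k5', k6'⟩ := bc'
      constructor <;> simp only [Pi.add_apply]
      · rw [k1, k1', add_zero]
      · rw [k2, k2']
      · linear_combination k3 + k3'
      · rw [k4, k4', add_zero]
      · linear_combination k5 + k5'
      · linear_combination k6 + k6'
    · simp only [Prod.mk_add_mk, EnergySpace.add_z] at *
      rw [y1, y1', smul_add]
    · simp only [Prod.mk_add_mk, EnergySpace.add_u₁] at *
      rw [y2, y2']
    · simp only [Prod.mk_add_mk, EnergySpace.add_u₂] at *
      rw [y3, y3']
    · simp only [Prod.mk_add_mk, EnergySpace.add_w₁] at *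
      rw [y4, y4']
      module
    · simp only [Prod.mk_add_mk, EnergySpace.add_w₂] at *
      rw [y5, y5']
      module
  zero_mem' := by
    refine ⟨0, 0, 0, 0, 0, 0, ⟨isWeakDeriv_zero, isWeakDeriv_zero, isWeakDeriv_zero,
      isWeakDeriv_zero, isWeakDeriv_zero, isWeakDeriv_zero⟩,
      ⟨0, 0, 0, 0, 0, 0, isContRep_zero, isContRep_zero, isContRep_zero, isContRep_zero,
        isContRep_zero, isContRep_zero, ?_⟩, ?_, ?_, ?_, ?_, ?_⟩
    · constructor <;> simp
    all_goals simp
  smul_mem' := by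
    rintro t ⟨X, Y⟩
      ⟨a, b, c, d, e, f, ⟨h1, h2, h3, h4, h5, h6⟩,
        ⟨f1, f2, f3, f4, f5, f6, r1, r2, r3, r4, r5, r6, bc⟩, y1, y2, y3, y4, y5⟩
    refine ⟨t • a, t • b, t • c, t • d, t • e, t • f,
      ⟨h1.smul t, h2.smul t, h3.smul t, h4.smul t, h5.smul t, h6.smul t⟩,
      ⟨t • f1, t • f2, t • f3, t • f4, t • f5, t • f6, r1.smul t, r2.smul t,
        r3.smul t, r4.smul t, r5.smul t, r6.smul t, ?_⟩, ?_, ?_, ?_, ?_, ?_⟩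
    · obtain ⟨k1, k2, k3, k4, k5, k6⟩ := bc
      constructor <;> simp only [Pi.smul_apply, smul_eq_mul]
      · rw [k1, mul_zero]
      · rw [k2]
      · linear_combination t * k3
      · rw [k4, mul_zero]
      · linear_combination t * k5
      · linear_combination t * k6
    · simp only [Prod.smul_mk, EnergySpace.smul_z] at *
      rw [y1, smul_comm]
    · simp only [Prod.smul_mk, EnergySpace.smul_u₁] at *
      rw [y2]
    · simp only [Prod.smul_mk, EnergySpace.smul_u₂] at *
      rw [y3]
    · simp only [Prod.smul_mk, EnergySpace.smul_w₁] at *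
      rw [y4]
      module
    · simp only [Prod.smul_mk, EnergySpace.smul_w₂] at *
      rw [y5]
      module

/-- The closed-loop relation is single-valued. -/
theorem beamGraph_functional (p : BeamParams) (q : EnergySpace p × EnergySpace p)
    (hq : q ∈ beamGraph p) (h0 : q.1 = 0) : q.2 = 0 := by
  obtain ⟨X, Y⟩ := q
  obtain ⟨a, b, c, d, e, f, ⟨h1, h2, h3, h4, h5, h6⟩, -, y1, y2, y3, y4, y5⟩ := hq
  simp only at h0 h1 h2 h3 h4 h5 h6 y1 y2 y3 y4 y5 ⊢
  subst h0
  have k1 : a = 0 := IsWeakDeriv.eq_zero h1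
  subst k1
  have k2 : b = 0 := IsWeakDeriv.eq_zero h2
  have k3 : c = 0 := IsWeakDeriv.eq_zero h3
  have k4 : d = 0 := IsWeakDeriv.eq_zero h4
  have k5 : e = 0 := IsWeakDeriv.eq_zero h5
  have k6 : f = 0 := IsWeakDeriv.eq_zero h6
  refine EnergySpace.ext' ?_ ?_ ?_ ?_ ?_
  · simp [y1, k2]
  · simp [y2, k5]
  · simp [y3, k6]
  · simp [y4, k3, k4]
  · simp [y5, k3, k4]

/-- The closed-loop operator `𝒜`, an unbounded operator on the energy space. -/
noncomputable def beamOperator (p : BeamParams) : EnergySpace p →ₗ.[ℂ] EnergySpace p :=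
  (beamGraph p).toLinearPMap

theorem mem_beamOperator_graph (p : BeamParams) (X Y : EnergySpace p) :
    (X, Y) ∈ (beamOperator p).graph ↔ BeamRel p X Y := by
  rw [beamOperator, Submodule.toLinearPMap_graph_eq _ (beamGraph_functional p)]
  rfl

theorem mem_beamOperator_domain (p : BeamParams) (X : EnergySpace p) :
    X ∈ (beamOperator p).domain ↔ ∃ Y, BeamRel p X Y := by
  rw [LinearPMap.mem_domain_iff]
  simp only [mem_beamOperator_graph]

/-! The beam operator `A` is dissipative and surjective, and on a Hilbert space these two properties
already force generation of a contraction semigroup (`exists_c0Semigroup_generator_eq`).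

Dissipativity is the energy balance (`BeamRel.re_inner_nonpos`). In the integrated form of `Re ⟨X,
AX⟩` the boundary terms at the joint cancel, and what remains is minus half of `κ‖ζ'‖² + ξ₁|w₁(l₂)|²
+ ξ₂|w₂(l₂)|²`. Surjectivity (`exists_beamRel`) comes from integrating the equations; the boundary
conditions reduce to one scalar equation with coefficient `κ + ξ₁ l₁ > 0`.

For the abstract part, `R = A⁻¹` is everywhere defined and dissipative, hence bounded, and its
range, the domain of `A`, is dense. The Yosida approximations `(R - ε)⁻¹ = A (1 - εA)⁻¹` are
bounded, dissipative and commute, and applied to `R y` they tend to `y`. Their exponentials are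
contractions that converge on the range of `R`, hence everywhere, to a semigroup `T`. The limit
satisfies `T(t) R y = R y + ∫₀ᵗ T(s) y ds`, so its generator extends `A`. The generator is
dissipative too, and `1 - R` is onto, so the extension cannot be proper. Uniqueness of classical
solutions follows from dissipativity alone. -/

/-! ### Contraction semigroups generated by dissipative operators with bounded inverse -/

section Dissipative

variable {H : Type*} [NormedAddCommGroup H] [InnerProductSpace ℂ H]

/-- A curve along which the velocity is dissipative has nonincreasing norm. -/
theorem norm_le_norm_zero_of_re_inner_nonpos {u u' : ℝ → H}
    (hu : ∀ t, 0 ≤ t → HasDerivWithinAt u (u' t) (Ici 0) t)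
    (hd : ∀ t, 0 ≤ t → (inner ℂ (u t) (u' t)).re ≤ 0) {t : ℝ} (ht : 0 ≤ t) :
    ‖u t‖ ≤ ‖u 0‖ := by
  -- The real inner product is by definition the real part of the complex one, so `hd` controls the
  -- sign of the derivative of the squared norm.
  let _ : InnerProductSpace ℝ H := InnerProductSpace.rclikeToReal ℂ H
  have hder : ∀ s, 0 ≤ s →
      HasDerivWithinAt (fun s => ‖u s‖ ^ 2) (2 * inner ℝ (u s) (u' s)) (Ici 0) s :=
    fun s hs => (hu s hs).norm_sq
  have hanti : AntitoneOn (fun s => ‖u s‖ ^ 2) (Ici 0) := by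
    refine antitoneOn_of_hasDerivWithinAt_nonpos (f' := fun s => 2 * inner ℝ (u s) (u' s))
      (convex_Ici 0) (fun s hs => (hder s hs).continuousWithinAt)
      (fun s hs => ?_) (fun s hs => ?_)
    · rw [interior_Ici] at hs ⊢
      exact (hder s (le_of_lt hs)).mono Ioi_subset_Ici_self
    · rw [interior_Ici] at hs
      have h1 : inner ℝ (u s) (u' s) ≤ 0 := hd s (le_of_lt hs)
      linarith
  have h2 : ‖u t‖ ^ 2 ≤ ‖u 0‖ ^ 2 := hanti (mem_Ici.mpr le_rfl) ht ht
  exact (pow_le_pow_iff_left₀ (norm_nonneg _) (norm_nonneg _) two_ne_zero).mp h2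

variable [CompleteSpace H]

theorem hasDerivAt_exp_smul_apply (B : H →L[ℂ] H) (x : H) (t : ℝ) :
    HasDerivAt (fun s : ℝ => NormedSpace.exp (s • B) x) (NormedSpace.exp (t • B) (B x)) t := by
  have h := hasDerivAt_exp_smul_const (𝕂 := ℝ) B t
  exact ((ContinuousLinearMap.apply ℂ H x).restrictScalars ℝ).hasFDerivAt.comp_hasDerivAt t h

theorem exp_smul_apply_comm {B C : H →L[ℂ] H} (h : Commute B C) (t : ℝ) (x : H) :
    NormedSpace.exp (t • B) (C x) = C (NormedSpace.exp (t • B) x) := by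
  have h1 : Commute (NormedSpace.exp (t • B)) C := (h.smul_left t).exp_left
  exact DFunLike.congr_fun h1.eq x

theorem norm_exp_smul_apply_le {B : H →L[ℂ] H} (hB : ∀ x, (inner ℂ x (B x)).re ≤ 0) {t : ℝ}
    (ht : 0 ≤ t) (x : H) : ‖NormedSpace.exp (t • B) x‖ ≤ ‖x‖ := by
  have h := norm_le_norm_zero_of_re_inner_nonpos
    (u := fun s : ℝ => NormedSpace.exp (s • B) x)
    (fun s _ => (hasDerivAt_exp_smul_apply B x s).hasDerivWithinAt)
    (fun s _ => by
      rw [exp_smul_apply_comm (Commute.refl B)]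
      exact hB _) ht
  simpa using h

/-- The curve `s ↦ exp((t - s)C) exp(sB) x` joins the two vectors. As `B` and `C` commute, its
velocity is `Bx - Cx` moved by two contractions. -/
theorem norm_exp_smul_apply_sub_le {B C : H →L[ℂ] H} (hB : ∀ x, (inner ℂ x (B x)).re ≤ 0)
    (hC : ∀ x, (inner ℂ x (C x)).re ≤ 0) (hBC : Commute B C) {t : ℝ} (ht : 0 ≤ t) (x : H) :
    ‖NormedSpace.exp (t • B) x - NormedSpace.exp (t • C) x‖ ≤ ‖B x - C x‖ * t := by
  have hder : ∀ s : ℝ, HasDerivAt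
      (fun s : ℝ => NormedSpace.exp ((t - s) • C) (NormedSpace.exp (s • B) x))
      (NormedSpace.exp ((t - s) • C) (NormedSpace.exp (s • B) (B x - C x))) s := by
    intro s
    have h1 := (hasDerivAt_exp_smul_const (𝕂 := ℝ) C (t - s)).scomp s
      ((hasDerivAt_id s).const_sub t)
    have h2 := h1.mul (hasDerivAt_exp_smul_const (𝕂 := ℝ) B s)
    have h3 := ((ContinuousLinearMap.apply ℂ H x).restrictScalars ℝ).hasFDerivAt.comp_hasDerivAt s h2
    refine h3.congr_deriv ?_
    simp only [Function.comp_apply, neg_smul, one_smul,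
      ContinuousLinearMap.coe_restrictScalars', ContinuousLinearMap.apply_apply,
      add_apply, mul_apply_eq_comp,
      neg_apply, map_sub, neg_mul, exp_smul_apply_comm hBC]
    abel
  have h := norm_image_sub_le_of_norm_deriv_le_segment' (a := 0) (b := t) (C := ‖B x - C x‖)
    (fun s _ => (hder s).hasDerivWithinAt) (fun s hs =>
      (norm_exp_smul_apply_le hC (sub_nonneg.mpr hs.2.le) _).trans
        (norm_exp_smul_apply_le hB hs.1 _)) t ⟨ht, le_rfl⟩
  simpa using h

theorem norm_exp_smul_apply_sub_apply_le {B : H →L[ℂ] H} (hB : ∀ x, (inner ℂ x (B x)).re ≤ 0)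
    {s t : ℝ} (hs : 0 ≤ s) (hst : s ≤ t) (x : H) :
    ‖NormedSpace.exp (t • B) x - NormedSpace.exp (s • B) x‖ ≤ ‖B x‖ * (t - s) :=
  norm_image_sub_le_of_norm_deriv_le_segment' (a := s) (b := t)
    (fun r _ => (hasDerivAt_exp_smul_apply B x r).hasDerivWithinAt)
    (fun _ hr => norm_exp_smul_apply_le hB (hs.trans hr.1) _) t ⟨hst, le_rfl⟩

theorem exp_smul_apply_sub_eq_integral (B : H →L[ℂ] H) (x : H) (t : ℝ) :
    NormedSpace.exp (t • B) x - x = ∫ s in (0 : ℝ)..t, NormedSpace.exp (s • B) (B x) := by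
  rw [intervalIntegral.integral_eq_sub_of_hasDerivAt
    (fun s _ => hasDerivAt_exp_smul_apply B x s)
    ((Continuous.intervalIntegrable (by
      exact continuous_iff_continuousAt.mpr fun s =>
        (hasDerivAt_exp_smul_apply B (B x) s).continuousAt)) _ _)]
  simp

/-- An everywhere defined dissipative linear map on a Hilbert space is bounded. -/
theorem LinearMap.continuous_of_re_inner_nonpos (R : H →ₗ[ℂ] H)
    (hR : ∀ y, (inner ℂ (R y) y).re ≤ 0) : Continuous R := by
  refine R.continuous_of_seq_closed_graph fun u x y hu hRu => ?_
  -- Closed graph theorem with Minty's trick: the inequality survives the limit, and `v = x - t w`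
  -- with `w = y - R x` and `t → 0+` then forces `w = 0`.
  have key : ∀ v, (inner ℂ (y - R v) (x - v)).re ≤ 0 := by
    intro v
    have h1 : Tendsto (fun k => (inner ℂ (R (u k) - R v) (u k - v)).re) atTop
        (𝓝 (inner ℂ (y - R v) (x - v)).re) :=
      (Complex.continuous_re.tendsto _).comp
        ((hRu.sub_const (R v)).inner (hu.sub_const v))
    refine le_of_tendsto' h1 fun k => ?_
    rw [← map_sub]
    exact hR _
  by_contra hne
  set w := y - R x with hw
  have ha : 0 < ‖w‖ ^ 2 := by
    have : w ≠ 0 := sub_ne_zero.mpr hne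
    positivity
  set c := (inner ℂ (R w) w).re with hc
  have hlin : ∀ t : ℝ, 0 < t → ‖w‖ ^ 2 + t * c ≤ 0 := by
    intro t ht
    have h1 := key (x - (t : ℂ) • w)
    have e1 : y - R (x - (t : ℂ) • w) = w + (t : ℂ) • R w := by
      rw [map_sub, map_smul, hw]; abel
    have e2 : x - (x - (t : ℂ) • w) = (t : ℂ) • w := by abel
    rw [e1, e2, inner_add_left, inner_smul_right, inner_smul_left, inner_smul_right,
      inner_self_eq_norm_sq_to_K] at h1
    have e3 : ((t : ℂ) * (‖w‖ : ℂ) ^ 2 + (starRingEnd ℂ) (t : ℂ) * ((t : ℂ) * inner ℂ (R w) w)).re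
        = t * (‖w‖ ^ 2 + t * c) := by
      rw [Complex.conj_ofReal, Complex.add_re, Complex.re_ofReal_mul, Complex.re_ofReal_mul,
        Complex.re_ofReal_mul, ← Complex.ofReal_pow, Complex.ofReal_re, hc]
      ring
    have h2 : t * (‖w‖ ^ 2 + t * c) ≤ 0 := e3 ▸ h1
    exact nonpos_of_mul_nonpos_right h2 ht
  have hc0 : -(|c| + 1) ≤ c := by linarith [neg_abs_le c]
  have hpos : 0 < |c| + 1 := by positivity
  -- This `t` is small enough that `t * c ≥ -‖w‖² / 2`; the summand `1` avoids division by zero.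
  have h3 := hlin (‖w‖ ^ 2 / (2 * (|c| + 1))) (by positivity)
  have h4 : ‖w‖ ^ 2 / (2 * (|c| + 1)) * -(|c| + 1) ≤ ‖w‖ ^ 2 / (2 * (|c| + 1)) * c := by
    gcongr
  have h5 : ‖w‖ ^ 2 / (2 * (|c| + 1)) * -(|c| + 1) = -(‖w‖ ^ 2 / 2) := by
    field_simp
  linarith

end Dissipative

/-! ### Yosida approximation -/

section Yosida

variable {H : Type*} [NormedAddCommGroup H] [InnerProductSpace ℂ H]

theorem re_inner_smul_one_sub_apply (R : H →L[ℂ] H) (ε : ℝ) (x : H) :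
    (inner ℂ ((ε • (1 : H →L[ℂ] H) - R) x) x).re = ε * ‖x‖ ^ 2 - (inner ℂ (R x) x).re := by
  have e : (ε • (1 : H →L[ℂ] H) - R) x = (ε : ℂ) • x - R x := by
    simp
  have h : (inner ℂ x x).re = ‖x‖ ^ 2 := inner_self_eq_norm_sq (𝕜 := ℂ) x
  rw [e, inner_sub_left, inner_smul_left, Complex.conj_ofReal, Complex.sub_re,
    Complex.re_ofReal_mul, h]

variable [CompleteSpace H]

/-- Lax–Milgram: dissipativity of `R` makes `ε - R` coercive with constant `ε`. -/
theorem isUnit_smul_one_sub {R : H →L[ℂ] H} (hR : ∀ y, (inner ℂ (R y) y).re ≤ 0) {ε : ℝ}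
    (hε : 0 < ε) : IsUnit (ε • (1 : H →L[ℂ] H) - R) := by
  refine ContinuousLinearMap.isUnit_of_forall_le_norm_inner_map _ (c := ⟨ε, hε.le⟩) hε fun x => ?_
  calc ‖x‖ ^ 2 * ε ≤ (inner ℂ ((ε • (1 : H →L[ℂ] H) - R) x) x).re := by
        rw [re_inner_smul_one_sub_apply]
        linarith [hR x]
    _ ≤ _ := Complex.re_le_norm _

/-- Write a vector orthogonal to the range as `w - R w`. Orthogonality to `R w` gives `Re ⟨R w, w⟩ =
‖R w‖²`, so dissipativity yields `R w = 0`, and injectivity `w = 0`. -/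
theorem denseRange_of_re_inner_nonpos {R : H →L[ℂ] H} (hR : ∀ y, (inner ℂ (R y) y).re ≤ 0)
    (hinj : Function.Injective R) : DenseRange R := by
  have h : (LinearMap.range (R : H →ₗ[ℂ] H)).topologicalClosure = ⊤ := by
    rw [Submodule.topologicalClosure_eq_top_iff, Submodule.eq_bot_iff]
    intro z hz
    obtain ⟨w, hw⟩ := (ContinuousLinearMap.isUnit_iff_bijective.mp
      (isUnit_smul_one_sub hR one_pos)).2 z
    have h1 : inner ℂ (R w) z = 0 := hz _ (LinearMap.mem_range_self (R : H →ₗ[ℂ] H) w)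
    have e : z = w - R w := by rw [← hw]; simp
    rw [e, inner_sub_right] at h1
    have h2 : (inner ℂ (R w) w).re = ‖R w‖ ^ 2 := by
      rw [sub_eq_zero.mp h1]
      exact inner_self_eq_norm_sq (𝕜 := ℂ) (R w)
    have h3 : R w = 0 := by
      have h4 := hR w
      rw [h2] at h4
      have h5 : ‖R w‖ ^ 2 = 0 := le_antisymm h4 (by positivity)
      simpa using h5
    have h6 : w = 0 := hinj (by rw [h3, map_zero])
    rw [e, h6, map_zero, sub_zero]
  rw [DenseRange, ← Submodule.dense_iff_topologicalClosure_eq_top] at *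
  exact h

/-- Bounded dissipative approximations of the unbounded inverse of `R`. -/
theorem exists_yosida_approximation {R : H →L[ℂ] H} (hR : ∀ y, (inner ℂ (R y) y).re ≤ 0)
    (hinj : Function.Injective R) :
    ∃ A : ℕ → H →L[ℂ] H, (∀ n x, (inner ℂ x (A n x)).re ≤ 0) ∧ (∀ m n, Commute (A m) (A n)) ∧
      (∀ n, Commute (A n) R) ∧ ∀ y, Tendsto (fun n => A n (R y)) atTop (𝓝 y) := by
  set ε : ℕ → ℝ := fun n => 1 / ((n : ℝ) + 1) with hεdef
  have hε : ∀ n, 0 < ε n := fun n => Nat.one_div_pos_of_nat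
  have hlim : Tendsto ε atTop (𝓝 0) := tendsto_one_div_add_atTop_nhds_zero_nat
  choose u hu using fun n => isUnit_smul_one_sub hR (hε n)
  set Q : ℕ → H →L[ℂ] H := fun n => ((u n)⁻¹ : (H →L[ℂ] H)ˣ) with hQ
  have hPQ : ∀ n x, ε n • Q n x - R (Q n x) = x := by
    intro n x
    have h := DFunLike.congr_fun ((u n).mul_inv) x
    rw [hu n] at h
    simpa using h
  have hcR : ∀ n, Commute ((u n : (H →L[ℂ] H)ˣ) : H →L[ℂ] H) R := by
    intro n
    rw [hu n]
    exact ((Commute.one_left R).smul_left _).sub_left (Commute.refl R)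
  have hcu : ∀ m n, Commute ((u m : (H →L[ℂ] H)ˣ) : H →L[ℂ] H) (u n : (H →L[ℂ] H)ˣ) := by
    intro m n
    rw [hu n]
    exact (((Commute.one_right _).smul_right _)).sub_right (hcR m)
  have hQR : ∀ n, Commute (Q n) R := fun n => (hcR n).units_inv_left
  have hQR' : ∀ n x, Q n (R x) = R (Q n x) := fun n x => DFunLike.congr_fun (hQR n).eq x
  -- Pair `x = (ε - R) Q x` with `Q x`: dissipativity gives `ε‖Q x‖² ≤ ‖x‖ ‖Q x‖`.
  have hbound : ∀ n x, ‖ε n • Q n x‖ ≤ ‖x‖ := by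
    intro n x
    have h1 := re_inner_smul_one_sub_apply R (ε n) (Q n x)
    have e : (ε n • (1 : H →L[ℂ] H) - R) (Q n x) = x := by simpa using hPQ n x
    rw [e] at h1
    have h2 : (inner ℂ x (Q n x)).re ≤ ‖x‖ * ‖Q n x‖ :=
      (Complex.re_le_norm _).trans (norm_inner_le_norm _ _)
    have h3 := hR (Q n x)
    rw [norm_smul, Real.norm_of_nonneg (hε n).le]
    rcases (norm_nonneg (Q n x)).eq_or_lt with h0 | h0
    · rw [← h0]; simp
    · refine le_of_mul_le_mul_right ?_ h0
      nlinarith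
  -- On the range, `εQ R w = ε(εQ w - w)` has norm at most `2ε‖w‖`; density and the uniform bound do
  -- the rest.
  have hsmall : ∀ y, Tendsto (fun n => ε n • Q n y) atTop (𝓝 0) := by
    intro y
    rw [Metric.tendsto_atTop]
    intro δ hδ
    obtain ⟨w, hw⟩ := (denseRange_of_re_inner_nonpos hR hinj).exists_dist_lt y (half_pos hδ)
    have hlim2 : Tendsto (fun n => ε n * (2 * ‖w‖)) atTop (𝓝 0) := by
      simpa using hlim.mul_const (2 * ‖w‖)
    obtain ⟨N, hN⟩ := (hlim2.eventually (gt_mem_nhds (half_pos hδ))).exists_forall_of_atTop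
    refine ⟨N, fun n hn => ?_⟩
    have e : ε n • Q n y = ε n • Q n (y - R w) + ε n • (ε n • Q n w - w) := by
      have h1 : R (Q n w) = ε n • Q n w - w := by
        rw [eq_sub_iff_add_eq, ← eq_sub_iff_add_eq']
        exact (hPQ n w).symm
      rw [map_sub, hQR', h1, smul_sub]; abel
    rw [dist_zero_right, e]
    have h2 : ‖ε n • Q n (y - R w)‖ < δ / 2 := (hbound n _).trans_lt (by rwa [← dist_eq_norm])
    have h3 : ‖ε n • (ε n • Q n w - w)‖ ≤ ε n * (2 * ‖w‖) := by
      rw [norm_smul, Real.norm_of_nonneg (hε n).le]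
      have h4 := norm_sub_le (ε n • Q n w) w
      have h5 := hbound n w
      have h6 := (hε n).le
      gcongr
      linarith
    linarith [norm_add_le (ε n • Q n (y - R w)) (ε n • (ε n • Q n w - w)), hN n hn]
  refine ⟨fun n => -Q n, fun n x => ?_, fun m n => ?_, fun n => (hQR n).neg_left, fun y => ?_⟩
  · have h1 := re_inner_smul_one_sub_apply R (ε n) (Q n x)
    have e : (ε n • (1 : H →L[ℂ] H) - R) (Q n x) = x := by simpa using hPQ n x
    rw [e] at h1
    have h3 := hR (Q n x)
    have h4 : 0 ≤ ε n * ‖Q n x‖ ^ 2 := mul_nonneg (hε n).le (by positivity)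
    rw [neg_apply, inner_neg_right, Complex.neg_re]
    linarith
  · exact ((hcu m n).units_inv_right.units_inv_left.neg_left).neg_right
  · have e : ∀ n, (-Q n) (R y) = y - ε n • Q n y := by
      intro n
      have := hPQ n y
      rw [neg_apply, hQR']
      nth_rewrite 2 [← this]
      abel
    simp only [e]
    simpa using (hsmall y).const_sub y

end Yosida

/-! ### The limit semigroup -/

section Limit

variable {H : Type*} [NormedAddCommGroup H] [InnerProductSpace ℂ H] [CompleteSpace H]

/-- A sequence of commuting bounded dissipative operators that converges pointwise on a dense set
defines a contraction semigroup in the limit. -/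
theorem exists_c0Semigroup_of_tendsto {A : ℕ → H →L[ℂ] H} {R : H → H}
    (hA : ∀ n x, (inner ℂ x (A n x)).re ≤ 0) (hcomm : ∀ m n, Commute (A m) (A n))
    (hlim : ∀ y, Tendsto (fun n => A n (R y)) atTop (𝓝 y)) (hR : DenseRange R) :
    ∃ T : C0Semigroup H, (∀ t x, ‖T.toFun t x‖ ≤ ‖x‖) ∧
      ∀ (t : ℝ≥0) x, Tendsto (fun n => NormedSpace.exp ((t : ℝ) • A n) x) atTop
        (𝓝 (T.toFun t x)) := by
  have hcontr : ∀ (n : ℕ) (t : ℝ≥0) x, ‖NormedSpace.exp ((t : ℝ) • A n) x‖ ≤ ‖x‖ :=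
    fun n t x => norm_exp_smul_apply_le (hA n) t.coe_nonneg x
  have hcauchyR : ∀ (t : ℝ≥0) y,
      CauchySeq (fun n => NormedSpace.exp ((t : ℝ) • A n) (R y)) := by
    intro t y
    have hc := (hlim y).cauchySeq
    rw [Metric.cauchySeq_iff] at hc ⊢
    intro δ hδ
    -- Dividing by `t + 1` instead of `t` covers `t = 0`.
    obtain ⟨N, hN⟩ := hc (δ / (t + 1)) (by positivity)
    refine ⟨N, fun m hm n hn => ?_⟩
    rw [dist_eq_norm]
    have h1 := norm_exp_smul_apply_sub_le (hA m) (hA n) (hcomm m n) t.coe_nonneg (R y)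
    have h2 := hN m hm n hn
    rw [dist_eq_norm, lt_div_iff₀ (by positivity)] at h2
    have h3 := norm_nonneg (A m (R y) - A n (R y))
    nlinarith
  have hcauchy : ∀ (t : ℝ≥0) x, CauchySeq (fun n => NormedSpace.exp ((t : ℝ) • A n) x) := by
    intro t x
    rw [Metric.cauchySeq_iff]
    intro δ hδ
    obtain ⟨y, hy⟩ := hR.exists_dist_lt x (by positivity : 0 < δ / 3)
    obtain ⟨N, hN⟩ := Metric.cauchySeq_iff.mp (hcauchyR t y) (δ / 3) (by positivity)
    refine ⟨N, fun m hm n hn => ?_⟩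
    have h1 : ∀ k, dist (NormedSpace.exp ((t : ℝ) • A k) x)
        (NormedSpace.exp ((t : ℝ) • A k) (R y)) < δ / 3 := by
      intro k
      rw [dist_eq_norm, ← map_sub]
      exact (hcontr k t _).trans_lt (by rwa [← dist_eq_norm])
    linarith [h1 m, h1 n, hN m hm n hn, dist_triangle4 (NormedSpace.exp ((t : ℝ) • A m) x)
      (NormedSpace.exp ((t : ℝ) • A m) (R y)) (NormedSpace.exp ((t : ℝ) • A n) (R y))
      (NormedSpace.exp ((t : ℝ) • A n) x), dist_comm (NormedSpace.exp ((t : ℝ) • A n) (R y))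
      (NormedSpace.exp ((t : ℝ) • A n) x)]
  choose f hf using fun t x => cauchySeq_tendsto_of_complete (hcauchy t x)
  have hfn : ∀ t x, ‖f t x‖ ≤ ‖x‖ := fun t x =>
    le_of_tendsto' (hf t x).norm fun n => hcontr n t x
  let F : ℝ≥0 → H →L[ℂ] H := fun t =>
    continuousLinearMapOfTendsto (fun n => NormedSpace.exp ((t : ℝ) • A n)) (f := f t)
      (tendsto_pi_nhds.mpr (hf t))
  have hF : ∀ t x, F t x = f t x := fun t x => rfl
  -- The approximating orbits have Lipschitz constants `‖A n (R y)‖`, which tend to `‖y‖`. Other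
  -- orbits are uniform limits of these, by contractivity.
  have hlip : ∀ y, LipschitzWith ‖y‖₊ (fun t : ℝ≥0 => f t (R y)) := by
    intro y
    have hle : ∀ s t : ℝ≥0, s ≤ t → dist (f t (R y)) (f s (R y)) ≤ ‖y‖ * dist t s := by
      intro s t hst
      have hst' : (s : ℝ) ≤ t := hst
      rw [dist_eq_norm, NNReal.dist_eq, abs_of_nonneg (sub_nonneg.mpr hst')]
      exact le_of_tendsto_of_tendsto' ((hf t (R y)).sub (hf s (R y))).norm
        ((hlim y).norm.mul_const _)
        fun n => norm_exp_smul_apply_sub_apply_le (hA n) s.coe_nonneg hst (R y)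
    refine LipschitzWith.of_dist_le_mul fun s t => ?_
    rcases le_total s t with h | h
    · rw [dist_comm, dist_comm s t]
      exact hle s t h
    · exact hle t s h
  have hcont : ∀ x, Continuous fun t : ℝ≥0 => f t x := by
    intro x
    refine continuous_of_uniform_approx_of_continuous fun u hu => ?_
    obtain ⟨δ, hδ, hu⟩ := Metric.mem_uniformity_dist.mp hu
    obtain ⟨y, hy⟩ := hR.exists_dist_lt x hδ
    refine ⟨fun t => f t (R y), (hlip y).continuous, fun t => hu ?_⟩
    change dist (F t x) (F t (R y)) < δ
    rw [dist_eq_norm, ← map_sub, hF]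
    exact (hfn t _).trans_lt (by rwa [← dist_eq_norm])
  refine ⟨⟨F, ?_, fun s t => ?_, hcont⟩, hfn, hf⟩
  · ext x
    refine tendsto_nhds_unique (hf 0 x) ?_
    simp
  · ext x
    refine tendsto_nhds_unique (hf (s + t) x) ?_
    -- Operator and argument both vary with `n`; contractivity kills the term carrying the error in
    -- the argument.
    have e : ∀ n, NormedSpace.exp (((s + t : ℝ≥0) : ℝ) • A n) x
        = NormedSpace.exp ((s : ℝ) • A n) (NormedSpace.exp ((t : ℝ) • A n) x - f t x)
          + NormedSpace.exp ((s : ℝ) • A n) (f t x) := by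
      intro n
      let _ : NormedAlgebra ℚ (H →L[ℂ] H) := NormedAlgebra.restrictScalars ℚ ℝ _
      rw [← map_add, sub_add_cancel, NNReal.coe_add, add_smul,
        NormedSpace.exp_add_of_commute (((Commute.refl (A n)).smul_left _).smul_right _)]
      rfl
    simp only [e]
    have h1 : Tendsto (fun n => NormedSpace.exp ((s : ℝ) • A n)
        (NormedSpace.exp ((t : ℝ) • A n) x - f t x)) atTop (𝓝 0) := by
      refine squeeze_zero_norm (fun n => hcontr n s _) ?_
      have := ((hf t x).sub_const (f t x)).norm
      simpa using this
    have h2 := h1.add (hf s (f t x))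
    rwa [zero_add] at h2

end Limit

/-! ### Generation and classical solutions -/

section Generation

variable {H : Type*} [NormedAddCommGroup H] [InnerProductSpace ℂ H]

/-- A surjective dissipative operator is injective. -/
theorem LinearPMap.eq_zero_of_apply_eq_zero {A : H →ₗ.[ℂ] H}
    (hd : ∀ x : A.domain, (inner ℂ (x : H) (A x)).re ≤ 0) (hs : ∀ y, ∃ x : A.domain, A x = y)
    {v : A.domain} (hv : A v = 0) : v = 0 := by
  obtain ⟨x, hx⟩ := hs v
  -- Dissipativity at `x + s v`, whose image is `v` for every `s`. The left side is affine in `s`,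
  -- so its slope must vanish; the `s` used below makes it equal to `1`.
  have key : ∀ s : ℝ, (inner ℂ (x : H) (v : H)).re + s * ‖(v : H)‖ ^ 2 ≤ 0 := by
    intro s
    have h1 := hd (x + (s : ℂ) • v)
    have h2 : (inner ℂ (v : H) (v : H)).re = ‖(v : H)‖ ^ 2 :=
      inner_self_eq_norm_sq (𝕜 := ℂ) (v : H)
    rw [map_add, map_smul, hv, hx, smul_zero, add_zero, Submodule.coe_add, Submodule.coe_smul,
      inner_add_left, inner_smul_left, Complex.conj_ofReal, Complex.add_re,
      Complex.re_ofReal_mul, h2] at h1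
    exact h1
  by_contra hne
  have hpos : 0 < ‖(v : H)‖ ^ 2 := by
    have : (v : H) ≠ 0 := fun h => hne (Subtype.ext h)
    positivity
  have h1 := key ((1 - (inner ℂ (x : H) (v : H)).re) / ‖(v : H)‖ ^ 2)
  rw [div_mul_cancel₀ _ hpos.ne'] at h1
  linarith

/-- Classical solutions of a dissipative equation are unique. -/
theorem IsClassicalSolution.eq_of_dissipative {A : H →ₗ.[ℂ] H}
    (hd : ∀ x : A.domain, (inner ℂ (x : H) (A x)).re ≤ 0) {x₀ : H} {u v : ℝ → H}
    (hu : IsClassicalSolution A x₀ u) (hv : IsClassicalSolution A x₀ v) {t : ℝ} (ht : 0 ≤ t) :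
    u t = v t := by
  choose au hu' using hu.equation
  choose av hv' using hv.equation
  have h := norm_le_norm_zero_of_re_inner_nonpos (u := u - v)
    -- A total function is needed here, while `A (u s)` makes sense only together with a proof that
    -- `u s` is in the domain.
    (u' := derivWithin (u - v) (Ici 0))
    (fun s hs => ((hu' s hs).sub (hv' s hs)).differentiableWithinAt.hasDerivWithinAt)
    (fun s hs => by
      rw [((hu' s hs).sub (hv' s hs)).derivWithin (uniqueDiffOn_Ici 0 s hs), ← LinearPMap.map_sub]
      exact hd (⟨u s, au s hs⟩ - ⟨v s, av s hs⟩)) ht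
  rw [Pi.sub_apply, Pi.sub_apply, hu.initial, hv.initial, sub_self, norm_zero] at h
  exact sub_eq_zero.mp (norm_le_zero_iff.mp h)

/-- By Cauchy–Schwarz, `Re ⟨x, T(h) x - x⟩ ≤ ‖x‖ ‖T(h) x‖ - ‖x‖² ≤ 0`; divide by `h` and pass to the
limit. -/
theorem C0Semigroup.re_inner_generator_nonpos (T : C0Semigroup H)
    (hT : ∀ t x, ‖T.toFun t x‖ ≤ ‖x‖) {x y : H} (h : (x, y) ∈ T.generatorGraph) :
    (inner ℂ x y).re ≤ 0 := by
  have h0 : Tendsto (fun h : ℝ≥0 => (h : ℝ)⁻¹ • (T.toFun h x - x)) (𝓝[>] 0) (𝓝 y) := h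
  have h1 : Tendsto (fun h : ℝ≥0 => (inner ℂ x ((h : ℝ)⁻¹ • (T.toFun h x - x))).re) (𝓝[>] 0)
      (𝓝 (inner ℂ x y).re) :=
    (Complex.continuous_re.tendsto _).comp (tendsto_const_nhds.inner h0)
  refine le_of_tendsto' h1 fun h => ?_
  have h2 : (inner ℂ x x).re = ‖x‖ ^ 2 := inner_self_eq_norm_sq (𝕜 := ℂ) x
  have h3 : (inner ℂ x (T.toFun h x)).re ≤ ‖x‖ * ‖x‖ :=
    ((Complex.re_le_norm _).trans (norm_inner_le_norm _ _)).trans (by gcongr; exact hT h x)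
  have e : ((h : ℝ)⁻¹ • (T.toFun h x - x)) = ((h⁻¹ : ℝ) : ℂ) • (T.toFun h x - x) :=
    (Complex.coe_smul _ _).symm
  rw [e, inner_smul_right, Complex.re_ofReal_mul, inner_sub_right, Complex.sub_re, h2]
  exact mul_nonpos_of_nonneg_of_nonpos (by positivity) (by nlinarith)

variable [CompleteSpace H]

/-- A dissipative surjective operator on a Hilbert space generates a `C₀`-semigroup, which yields
the unique classical solutions. -/
theorem exists_c0Semigroup_generator_eq {A : H →ₗ.[ℂ] H}
    (hd : ∀ x : A.domain, (inner ℂ (x : H) (A x)).re ≤ 0) (hs : ∀ y, ∃ x : A.domain, A x = y) :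
    ∃ T : C0Semigroup H, T.generator = A ∧ ∀ x₀ ∈ A.domain,
      IsClassicalSolution A x₀ (fun t : ℝ => T.toFun t.toNNReal x₀) ∧
      ∀ u : ℝ → H, IsClassicalSolution A x₀ u → ∀ t : ℝ, 0 ≤ t → u t = T.toFun t.toNNReal x₀ := by
  have hinj : Function.Injective A.toFun :=
    (injective_iff_map_eq_zero A.toFun).mpr fun v hv => LinearPMap.eq_zero_of_apply_eq_zero hd hs hv
  let e := LinearEquiv.ofBijective A.toFun ⟨hinj, hs⟩
  let R₀ : H →ₗ[ℂ] H := A.domain.subtype ∘ₗ e.symm.toLinearMap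
  have hR₀A : ∀ x : A.domain, R₀ (A x) = x := fun x =>
    congrArg Subtype.val (e.symm_apply_apply x)
  have hR₀ : ∀ y, (inner ℂ (R₀ y) y).re ≤ 0 := by
    intro y
    obtain ⟨x, rfl⟩ := hs y
    rw [hR₀A]
    exact hd x
  let R : H →L[ℂ] H := ⟨R₀, R₀.continuous_of_re_inner_nonpos hR₀⟩
  have hRA : ∀ x : A.domain, R (A x) = x := hR₀A
  have hR : ∀ y, (inner ℂ (R y) y).re ≤ 0 := hR₀
  have hRdom : ∀ y, ∃ h : R y ∈ A.domain, A ⟨R y, h⟩ = y := by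
    intro y
    obtain ⟨x, rfl⟩ := hs y
    have h := hRA x
    refine ⟨h ▸ x.2, ?_⟩
    congr 1
    exact Subtype.ext h
  have hRinj : Function.Injective R := by
    intro y y' h
    obtain ⟨x, rfl⟩ := hs y
    obtain ⟨x', rfl⟩ := hs y'
    rw [hRA, hRA] at h
    rw [Subtype.ext h]
  obtain ⟨B, hB, hcomm, hBR, hlim⟩ := exists_yosida_approximation hR hRinj
  obtain ⟨T, hT, hBT⟩ := exists_c0Semigroup_of_tendsto hB hcomm hlim
    (denseRange_of_re_inner_nonpos hR hRinj)
  have hTR : ∀ t y, T.toFun t (R y) = R (T.toFun t y) := by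
    intro t y
    refine tendsto_nhds_unique (hBT t (R y)) ?_
    simp only [exp_smul_apply_comm (hBR _)]
    exact (R.continuous.tendsto _).comp (hBT t y)
  have horbit : ∀ y, Continuous fun s : ℝ => T.toFun s.toNNReal y := fun y =>
    (T.strongly_continuous y).comp continuous_real_toNNReal
  -- Limit of the same identity for `exp(t B n)`; the integrands are dominated by the supremum of
  -- `‖B n (R y)‖`.
  have hint : ∀ y, ∀ t : ℝ, 0 ≤ t →
      T.toFun t.toNNReal (R y) = R y + ∫ s in (0 : ℝ)..t, T.toFun s.toNNReal y := by
    intro y t ht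
    rw [← sub_eq_iff_eq_add']
    have h1 := (hBT t.toNNReal (R y)).sub_const (R y)
    refine tendsto_nhds_unique h1 ?_
    simp only [Real.coe_toNNReal t ht, exp_smul_apply_sub_eq_integral]
    obtain ⟨C, hC⟩ := (hlim y).norm.bddAbove_range
    refine intervalIntegral.tendsto_integral_filter_of_dominated_convergence (fun _ => C)
      (Eventually.of_forall fun n => ?_) (Eventually.of_forall fun n => ?_)
      intervalIntegrable_const ?_
    · exact (continuous_iff_continuousAt.mpr fun s =>
        (hasDerivAt_exp_smul_apply (B n) (B n (R y)) s).continuousAt).aestronglyMeasurable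
    · refine Eventually.of_forall fun s hs => ?_
      rw [uIoc_of_le ht] at hs
      exact (norm_exp_smul_apply_le (hB n) hs.1.le _).trans (hC ⟨n, rfl⟩)
    · refine Eventually.of_forall fun s hs => ?_
      rw [uIoc_of_le ht] at hs
      have h2 := hBT s.toNNReal y
      rw [Real.coe_toNNReal s hs.1.le] at h2
      have h3 : Tendsto (fun n => NormedSpace.exp (s • B n) (B n (R y) - y)) atTop (𝓝 0) := by
        refine squeeze_zero_norm (fun n => norm_exp_smul_apply_le (hB n) hs.1.le _) ?_
        have := ((hlim y).sub_const y).norm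
        simpa using this
      simpa using h3.add h2
  -- Truncating time by `toNNReal` makes the integrand continuous on all of `ℝ`, so the derivative
  -- is two-sided even at `0`.
  have hprim : ∀ y t, HasDerivAt (fun t : ℝ => R y + ∫ s in (0 : ℝ)..t, T.toFun s.toNNReal y)
      (T.toFun t.toNNReal y) t := fun y t =>
    ((horbit y).integral_hasStrictDerivAt 0 t).hasDerivAt.const_add _
  have hderiv : ∀ y t, 0 ≤ t → HasDerivWithinAt (fun t : ℝ => T.toFun t.toNNReal (R y))
      (T.toFun t.toNNReal y) (Ici 0) t := fun y t ht =>
    (hprim y t).hasDerivWithinAt.congr (fun s hs => hint y s hs) (hint y t ht)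
  have hgen : ∀ y, (R y, y) ∈ T.generatorGraph := by
    intro y
    have h1 := (hderiv y 0 le_rfl).Ioi_of_Ici
    rw [hasDerivWithinAt_iff_tendsto_slope' (by simp)] at h1
    have h2 : Tendsto (fun h : ℝ≥0 => (h : ℝ)) (𝓝[>] 0) (𝓝[>] 0) := by
      refine tendsto_nhdsWithin_iff.mpr ⟨?_, ?_⟩
      · exact (NNReal.continuous_coe.tendsto 0).mono_left nhdsWithin_le_nhds
      · filter_upwards [self_mem_nhdsWithin] with h hh
        exact hh
    have h3 := h1.comp h2
    simp only [Real.toNNReal_zero, T.map_zero, ContinuousLinearMap.id_apply] at h3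
    refine Tendsto.congr (fun h => ?_) h3
    simp [slope, T.map_zero]
  have hsol : ∀ x₀ ∈ A.domain,
      IsClassicalSolution A x₀ (fun t : ℝ => T.toFun t.toNNReal x₀) := by
    intro x₀ hx₀
    obtain ⟨y, rfl⟩ : ∃ y, R y = x₀ := ⟨A ⟨x₀, hx₀⟩, hRA ⟨x₀, hx₀⟩⟩
    refine ⟨by simp [T.map_zero], ?_, fun t ht => ?_⟩
    · have h1 : ContDiff ℝ 1
          (fun t : ℝ => R y + ∫ s in (0 : ℝ)..t, T.toFun s.toNNReal y) := by
        rw [contDiff_one_iff_deriv]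
        refine ⟨fun t => (hprim y t).differentiableAt, ?_⟩
        rw [funext fun t => (hprim y t).deriv]
        exact horbit y
      exact h1.contDiffOn.congr fun t ht => hint y t ht
    · obtain ⟨h1, h2⟩ := hRdom (T.toFun t.toNNReal y)
      rw [← hTR] at h1
      refine ⟨h1, ?_⟩
      have h3 : A ⟨T.toFun t.toNNReal (R y), h1⟩ = T.toFun t.toNNReal y := by
        rw [← h2]
        congr 1
        exact Subtype.ext (hTR _ _)
      rw [h3]
      exact hderiv y t ht
  refine ⟨T, LinearPMap.eq_of_eq_graph ?_, fun x₀ hx₀ => ⟨hsol x₀ hx₀, fun u hu t ht =>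
    hu.eq_of_dissipative hd (hsol x₀ hx₀) ht⟩⟩
  rw [C0Semigroup.generator, Submodule.toLinearPMap_graph_eq _ T.generatorGraph_functional]
  ext ⟨x, y⟩
  constructor
  · intro hxy
    -- With this `w`, the generator maps `x - R w` to itself; dissipativity then gives `x = R w` and
    -- `y = w`.
    obtain ⟨w, hw⟩ := (ContinuousLinearMap.isUnit_iff_bijective.mp
      (isUnit_smul_one_sub hR one_pos)).2 (y - x)
    have hw' : w - R w = y - x := by simpa using hw
    have h1 := T.generatorGraph.sub_mem hxy (hgen w)
    have h2 : y - w = x - R w := by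
      rw [sub_eq_sub_iff_add_eq_add] at hw' ⊢
      rw [add_comm x w, hw', add_comm]
    rw [Prod.mk_sub_mk, h2] at h1
    have h3 := T.re_inner_generator_nonpos hT h1
    have h4 : (inner ℂ (x - R w) (x - R w)).re = ‖x - R w‖ ^ 2 :=
      inner_self_eq_norm_sq (𝕜 := ℂ) (x - R w)
    have h5 : x - R w = 0 := by
      rw [h4] at h3
      have : ‖x - R w‖ ^ 2 = 0 := le_antisymm h3 (by positivity)
      simpa using this
    rw [h5] at h2
    rw [sub_eq_zero.mp h5, sub_eq_zero.mp h2, ← LinearPMap.image_iff (hRdom w).1]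
    exact (hRdom w).2.symm
  · intro hxy
    obtain ⟨v, hv, hv'⟩ := LinearPMap.mem_graph_iff _ |>.mp hxy
    simp only at hv hv'
    rw [← hv, ← hv', ← hRA v]
    have := hgen (A v)
    simpa only [hRA] using this

end Generation

/-! ### Integration by parts and the fundamental theorem of calculus on an interval -/

section IntervalCalculus

/-- Increments are dominated by those of the primitive of `‖f‖`, which reduces the claim to the
real-valued case. -/
theorem IntervalIntegrable.absolutelyContinuousOnInterval_primitive {E : Type*}
    [NormedAddCommGroup E] [NormedSpace ℝ E] {f : ℝ → E} {a b c : ℝ}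
    (h : IntervalIntegrable f volume a b) (hc : c ∈ uIcc a b) :
    AbsolutelyContinuousOnInterval (fun x => ∫ t in c..x, f t) a b := by
  have hN := h.norm.absolutelyContinuousOnInterval_intervalIntegral hc
  refine squeeze_zero' (Eventually.of_forall fun _ => Finset.sum_nonneg fun _ _ => dist_nonneg)
    ?_ hN
  rw [eventually_inf_principal]
  refine Eventually.of_forall fun E hE => Finset.sum_le_sum fun i hi => ?_
  obtain ⟨h1, h2⟩ := hE.1 i hi
  have hint : ∀ {x y}, x ∈ uIcc a b → y ∈ uIcc a b → IntervalIntegrable f volume x y :=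
    fun hx hy => h.mono_set (uIcc_subset_uIcc hx hy)
  rw [dist_comm, dist_comm (∫ t in c..(E.2 i).1, ‖f t‖), dist_eq_norm, dist_eq_norm,
    intervalIntegral.integral_interval_sub_left (hint hc h2) (hint hc h1),
    intervalIntegral.integral_interval_sub_left (hint hc h2).norm (hint hc h1).norm]
  exact intervalIntegral.norm_integral_le_abs_integral_norm

theorem AbsolutelyContinuousOnInterval.const_add {E : Type*} [NormedAddCommGroup E]
    {f : ℝ → E} {a b : ℝ} (c : E) (h : AbsolutelyContinuousOnInterval f a b) :
    AbsolutelyContinuousOnInterval (fun x => c + f x) a b := by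
  refine Tendsto.congr (fun E => ?_) h
  simp only [dist_add_left]

/-- Integration by parts for primitives of integrable functions. -/
theorem integral_mul_primitive_add_primitive_mul {f g : ℝ → ℂ} {l : ℝ}
    (hf : IntervalIntegrable f volume 0 l) (hg : IntervalIntegrable g volume 0 l) (a b : ℂ) :
    ∫ x in (0 : ℝ)..l, (f x * (b + ∫ t in (0 : ℝ)..x, g t) + (a + ∫ t in (0 : ℝ)..x, f t) * g x)
      = (a + ∫ t in (0 : ℝ)..l, f t) * (b + ∫ t in (0 : ℝ)..l, g t) - a * b := by
  set F : ℝ → ℂ := fun x => a + ∫ t in (0 : ℝ)..x, f t with hFdef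
  set G : ℝ → ℂ := fun x => b + ∫ t in (0 : ℝ)..x, g t with hGdef
  have hF : AbsolutelyContinuousOnInterval F 0 l :=
    (hf.absolutelyContinuousOnInterval_primitive left_mem_uIcc).const_add a
  have hG : AbsolutelyContinuousOnInterval G 0 l :=
    (hg.absolutelyContinuousOnInterval_primitive left_mem_uIcc).const_add b
  set k : ℝ → ℂ := fun x => f x * G x + F x * g x with hk
  have hkint : IntervalIntegrable k volume 0 l :=
    (hf.mul_continuousOn hG.continuousOn).add (hg.continuousOn_mul hF.continuousOn)
  have hK := hkint.absolutelyContinuousOnInterval_primitive left_mem_uIcc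
  -- This difference is absolutely continuous with derivative zero almost everywhere, hence
  -- constant.
  have hD : AbsolutelyContinuousOnInterval (fun x => F x * G x - ∫ t in (0 : ℝ)..x, k t) 0 l := by
    have h1 : AbsolutelyContinuousOnInterval (F • G) 0 l := hF.smul hG
    exact h1.sub hK
  obtain ⟨C, hC⟩ := hD.const_of_ae_hasDerivAt_zero (by
    filter_upwards [hf.ae_hasDerivAt_integral, hg.ae_hasDerivAt_integral,
      hkint.ae_hasDerivAt_integral] with x h1 h2 h3 hx
    have d1 := (h1 hx 0 left_mem_uIcc).const_add a
    have d2 := (h2 hx 0 left_mem_uIcc).const_add b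
    have d3 := h3 hx 0 left_mem_uIcc
    exact ((d1.mul d2).sub d3).congr_deriv (sub_self _))
  have e1 := hC l right_mem_uIcc
  have e0 := hC 0 left_mem_uIcc
  simp only [intervalIntegral.integral_same, sub_zero] at e0
  have e2 : F 0 = a := by simp [hFdef]
  have e3 : G 0 = b := by simp [hGdef]
  rw [e2, e3] at e0
  rw [← e0] at e1
  linear_combination -e1

theorem L2.intervalIntegrable {l : ℝ} (hl : 0 ≤ l) (g : L2 l) :
    IntervalIntegrable g volume 0 l := by
  rw [intervalIntegrable_iff_integrableOn_Ioc_of_le hl, integrableOn_Ioc_iff_integrableOn_Ioo]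
  exact (Lp.memLp g).integrable (by norm_num)

theorem setIntegral_Ioo_eq_intervalIntegral {l : ℝ} (hl : 0 ≤ l) (f : ℝ → ℂ) :
    ∫ x in Ioo 0 l, f x = ∫ x in (0 : ℝ)..l, f x := by
  rw [intervalIntegral.integral_of_le hl, integral_Ioc_eq_integral_Ioo]

/-- A test function is the primitive of its derivative and vanishes at both ends, so integration by
parts leaves no boundary terms. -/
theorem isWeakDeriv_of_primitive {l : ℝ} (hl : 0 ≤ l) {u g : L2 l} {c : ℂ}
    (hu : u =ᵐ[volume.restrict (Ioo (0 : ℝ) l)] fun x => c + ∫ t in (0 : ℝ)..x, g t) :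
    IsWeakDeriv u g := by
  intro φ hφ _ hsupp
  have hφ' : Continuous (deriv φ) := hφ.continuous_deriv (by simp)
  have hout : ∀ x, x ∉ Ioo 0 l → φ x = 0 := fun x hx =>
    image_eq_zero_of_notMem_tsupport fun h => hx (hsupp h)
  have hprim : ∀ x, (φ x : ℂ) = 0 + ∫ t in (0 : ℝ)..x, ((deriv φ t : ℝ) : ℂ) := by
    intro x
    rw [intervalIntegral.integral_ofReal, intervalIntegral.integral_deriv_eq_sub
      (fun y _ => hφ.differentiable (by simp) y) (hφ'.intervalIntegrable _ _),
      hout 0 (by simp)]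
    simp
  have hφc : Continuous fun x => ((φ x : ℝ) : ℂ) :=
    Complex.continuous_ofReal.comp hφ.continuous
  have hd : IntervalIntegrable (fun t => ((deriv φ t : ℝ) : ℂ)) volume 0 l :=
    (Complex.continuous_ofReal.comp hφ').intervalIntegrable _ _
  have hg := L2.intervalIntegrable hl g
  have key := integral_mul_primitive_add_primitive_mul hd hg 0 c
  rw [← hprim l, hout l (by simp)] at key
  simp only [← hprim] at key
  have hG := ((hg.absolutelyContinuousOnInterval_primitive left_mem_uIcc).const_add c).continuousOn
  rw [intervalIntegral.integral_add (hd.mul_continuousOn hG)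
    (hg.continuousOn_mul hφc.continuousOn), Complex.ofReal_zero] at key
  have e1 : ∫ x in Ioo 0 l, deriv φ x • u x
      = ∫ x in Ioo 0 l, ((deriv φ x : ℝ) : ℂ) * (c + ∫ t in (0 : ℝ)..x, g t) := by
    refine integral_congr_ae ?_
    filter_upwards [hu] with x hx
    rw [hx, Complex.real_smul]
  rw [e1]
  simp only [Complex.real_smul, setIntegral_Ioo_eq_intervalIntegral hl]
  linear_combination key

/-- Every `g ∈ L²(0, l)` has a primitive in `H¹(0, l)` with a prescribed value at `0`. -/
theorem exists_isWeakDeriv {l : ℝ} (hl : 0 ≤ l) (g : L2 l) (c : ℂ) :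
    ∃ u : L2 l, IsWeakDeriv u g ∧ IsContRep u fun x => c + ∫ t in (0 : ℝ)..x, g t := by
  set G : ℝ → ℂ := fun x => c + ∫ t in (0 : ℝ)..x, g t
  have hG : ContinuousOn G (Icc 0 l) := by
    have h := (((L2.intervalIntegrable hl g).absolutelyContinuousOnInterval_primitive
      left_mem_uIcc).const_add c).continuousOn
    rwa [uIcc_of_le hl] at h
  obtain ⟨C, hC⟩ := isCompact_Icc.exists_bound_of_continuousOn hG
  have hmem : MemLp G 2 (volume.restrict (Ioo (0 : ℝ) l)) :=
    MemLp.of_bound ((hG.mono Ioo_subset_Icc_self).aestronglyMeasurable measurableSet_Ioo) C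
      ((ae_restrict_iff' measurableSet_Ioo).mpr
        (Eventually.of_forall fun x hx => hC x (Ioo_subset_Icc_self hx)))
  exact ⟨hmem.toLp G, isWeakDeriv_of_primitive hl hmem.coeFn_toLp, hG, hmem.coeFn_toLp⟩

/-- A smooth function with vanishing mean and compact support in an interval is the derivative of
such a function. -/
theorem exists_deriv_eq_of_integral_eq_zero {l : ℝ} {χ : ℝ → ℝ} (hχ : ContDiff ℝ ∞ χ)
    (hc : HasCompactSupport χ) (hs : tsupport χ ⊆ Ioo 0 l) (h0 : ∫ x, χ x = 0) :
    ∃ Φ : ℝ → ℝ, ContDiff ℝ ∞ Φ ∧ HasCompactSupport Φ ∧ tsupport Φ ⊆ Ioo 0 l ∧ deriv Φ = χ := by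
  rcases (tsupport χ).eq_empty_or_nonempty with he | hne
  · have : χ = 0 := tsupport_eq_empty_iff.mp he
    subst this
    exact ⟨0, contDiff_const, HasCompactSupport.zero, by simp [tsupport], deriv_zero⟩
  obtain ⟨a, ha, ha'⟩ := hc.isCompact.exists_isLeast hne
  obtain ⟨b, hb, hb'⟩ := hc.isCompact.exists_isGreatest hne
  have hderiv : ∀ x, HasDerivAt (fun x => ∫ t in (0 : ℝ)..x, χ t) (χ x) x := fun x =>
    (hχ.continuous.integral_hasStrictDerivAt 0 x).hasDerivAt
  have hd : deriv (fun x => ∫ t in (0 : ℝ)..x, χ t) = χ := funext fun x => (hderiv x).deriv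
  -- Left of `a` the integrand vanishes; right of `b` the integral is the full mean, which is zero.
  have hsub : Function.support (fun x => ∫ t in (0 : ℝ)..x, χ t) ⊆ Icc a b := by
    intro x hx
    by_contra hxab
    refine hx ?_
    rw [mem_Icc, not_and_or, not_le, not_le] at hxab
    rcases hxab with h | h
    · refine intervalIntegral.integral_zero_ae (Eventually.of_forall fun t ht => ?_)
      refine image_eq_zero_of_notMem_tsupport fun hmem => ?_
      have h1 := ha' hmem
      have h2 := (mem_uIoc.mp ht)
      have h3 := (hs ha).1
      rcases h2 with h2 | h2 <;> linarith [h2.2]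
    · change ∫ t in (0 : ℝ)..x, χ t = 0
      rw [intervalIntegral.integral_eq_integral_of_support_subset, h0]
      intro t ht
      have hmem := subset_tsupport χ ht
      exact ⟨(hs hmem).1, (hb' hmem).trans h.le⟩
  have hts : tsupport (fun x => ∫ t in (0 : ℝ)..x, χ t) ⊆ Icc a b :=
    closure_minimal hsub isClosed_Icc
  refine ⟨fun x => ∫ t in (0 : ℝ)..x, χ t, ?_, ?_, ?_, hd⟩
  · rw [contDiff_infty_iff_deriv, hd]
    exact ⟨fun x => (hderiv x).differentiableAt, hχ⟩
  · exact HasCompactSupport.of_support_subset_isCompact isCompact_Icc hsub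
  · exact hts.trans fun x hx => ⟨(hs ha).1.trans_le hx.1, hx.2.trans_lt (hs hb).2⟩

/-- A function whose weak derivative vanishes is constant. -/
theorem IsWeakDeriv.ae_eq_const {l : ℝ} (hl : 0 < l) {u : L2 l} (h : IsWeakDeriv u 0) :
    ∃ c : ℂ, u =ᵐ[volume.restrict (Ioo (0 : ℝ) l)] fun _ => c := by
  let ψ : ContDiffBump (l / 2) := ⟨l / 8, l / 4, by positivity, by linarith⟩
  set η : ℝ → ℝ := ψ.normed volume with hη
  have hη1 : ContDiff ℝ ∞ η := ψ.contDiff_normed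
  have hη2 : HasCompactSupport η := ψ.hasCompactSupport_normed
  have hη3 : tsupport η ⊆ Ioo 0 l := by
    rw [hη, ψ.tsupport_normed_eq, Real.closedBall_eq_Icc]
    intro x hx
    have h1 : l / 2 - l / 4 ≤ x := hx.1
    have h2 : x ≤ l / 2 + l / 4 := hx.2
    constructor <;> linarith
  have hη4 : ∫ x, η x = 1 := ψ.integral_normed
  have hu : Integrable u (volume.restrict (Ioo (0 : ℝ) l)) :=
    (Lp.memLp u).integrable (by norm_num)
  set c := ∫ x in Ioo 0 l, η x • u x with hc
  refine ⟨c, ?_⟩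
  have hconst : IntegrableOn (fun _ : ℝ => c) (Ioo 0 l) volume := integrableOn_const (by simp)
  have hloc : LocallyIntegrableOn (fun x => u x - c) (Ioo 0 l) volume :=
    IntegrableOn.locallyIntegrableOn (hu.sub hconst)
  have key := isOpen_Ioo.ae_eq_zero_of_integral_contDiff_smul_eq_zero (μ := volume) hloc
    (fun φ h1 h2 h3 => by
      -- Du Bois-Reymond: subtracting a multiple of the unit-mass bump `η` gives mean zero, so the
      -- result is the derivative of a test function and is annihilated by `u`.
      have hχ1 : ContDiff ℝ ∞ (fun x => φ x - (∫ y, φ y) * η x) :=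
        h1.sub (contDiff_const.mul hη1)
      have hsub : tsupport (fun x => φ x - (∫ y, φ y) * η x) ⊆ tsupport φ ∪ tsupport η := by
        refine closure_minimal (fun x hx => ?_) ((isClosed_tsupport _).union (isClosed_tsupport _))
        by_contra hx'
        rw [mem_union, not_or] at hx'
        refine hx ?_
        change φ x - (∫ y, φ y) * η x = 0
        rw [image_eq_zero_of_notMem_tsupport hx'.1, image_eq_zero_of_notMem_tsupport hx'.2,
          mul_zero, sub_zero]
      have hφi : Integrable φ := h1.continuous.integrable_of_hasCompactSupport h2
      have hηi : Integrable η := hη1.continuous.integrable_of_hasCompactSupport hη2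
      obtain ⟨Φ, p1, p2, p3, p4⟩ := exists_deriv_eq_of_integral_eq_zero hχ1
        (HasCompactSupport.of_support_subset_isCompact (h2.isCompact.union hη2.isCompact)
          ((subset_tsupport _).trans hsub))
        (hsub.trans (union_subset h3 hη3)) (by
          rw [integral_sub hφi (hηi.const_mul _), integral_const_mul, hη4, mul_one, sub_self])
      have hw := h Φ p1 p2 p3
      have hz : ∫ x in Ioo 0 l, Φ x • (0 : L2 l) x = 0 := by
        refine integral_eq_zero_of_ae ?_
        filter_upwards [Lp.coeFn_zero ℂ 2 (volume.restrict (Ioo (0 : ℝ) l))] with x hx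
        rw [hx, Pi.zero_apply, smul_zero]
      rw [hz, neg_zero, p4] at hw
      have e1 : ∫ x in Ioo 0 l, (φ x - (∫ y, φ y) * η x) • u x
          = (∫ x in Ioo 0 l, φ x • u x) - (∫ y, φ y) • c := by
        rw [hc, ← integral_smul, ← integral_sub (integrable_smul_L2 h1.continuous h2 u)
          ((integrable_smul_L2 hη1.continuous hη2 u).fun_smul _)]
        simp only [sub_smul, mul_smul]
      have hφs : ∀ v : ℝ → ℂ, ∫ x in Ioo 0 l, φ x • v x = ∫ x, φ x • v x := fun v =>
        setIntegral_eq_integral_of_forall_compl_eq_zero fun x hx => by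
          rw [image_eq_zero_of_notMem_tsupport (fun hh => hx (h3 hh)), zero_smul]
      have e2 : ∫ x in Ioo 0 l, φ x • c = (∫ y, φ y) • c := by
        rw [hφs, integral_smul_const]
      rw [← hφs]
      simp only [smul_sub]
      rw [integral_sub (integrable_smul_L2 h1.continuous h2 u) (hφi.restrict.smul_const c), e2,
        ← e1, hw])
  have key' := (ae_restrict_iff' measurableSet_Ioo).mpr key
  filter_upwards [key'] with x hx
  exact sub_eq_zero.mp hx

/-- The fundamental theorem of calculus in `H¹(0, l)`. -/
theorem IsWeakDeriv.eqOn_primitive {l : ℝ} (hl : 0 < l) {u g : L2 l} (h : IsWeakDeriv u g)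
    {f : ℝ → ℂ} (hf : IsContRep u f) :
    EqOn f (fun x => f 0 + ∫ t in (0 : ℝ)..x, g t) (Icc 0 l) := by
  obtain ⟨v, hv, hvr⟩ := exists_isWeakDeriv hl.le g 0
  -- `u` minus a primitive of `g` is constant almost everywhere, hence on all of `[0, l]` for the
  -- continuous representatives; comparison at `0` fixes the constant.
  have h1 := h.add (hv.smul (-1))
  have h2 : g + (-1 : ℂ) • g = 0 := by simp
  rw [h2] at h1
  obtain ⟨c, hc⟩ := h1.ae_eq_const hl
  have hr := hf.add (hvr.smul (-1))
  have hE : EqOn (f + (-1 : ℂ) • fun x => 0 + ∫ t in (0 : ℝ)..x, g t) (fun _ => c) (Icc 0 l) := by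
    refine Measure.eqOn_Icc_of_ae_eq volume hl.ne ?_ hr.1 continuousOn_const
    rw [Measure.restrict_congr_set Ioo_ae_eq_Icc.symm]
    exact hr.2.symm.trans hc
  intro x hx
  have e1 := hE hx
  have e0 := hE (left_mem_Icc.mpr hl.le)
  simp only [Pi.add_apply, Pi.smul_apply, smul_eq_mul, intervalIntegral.integral_same] at e0 e1
  simp only
  linear_combination e1 - e0

/-- Integration by parts in `H¹(0, l)`. -/
theorem inner_add_inner_weakDeriv {l : ℝ} (hl : 0 < l) {u v du dv : L2 l} {f g : ℝ → ℂ}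
    (hu : IsWeakDeriv u du) (hv : IsWeakDeriv v dv) (hf : IsContRep u f) (hg : IsContRep v g) :
    inner ℂ u dv + inner ℂ du v
      = (starRingEnd ℂ) (f l) * g l - (starRingEnd ℂ) (f 0) * g 0 := by
  have hfE := hu.eqOn_primitive hl hf
  have hgE := hv.eqOn_primitive hl hg
  have hconj : ∀ x : ℝ, (starRingEnd ℂ) (∫ t in (0 : ℝ)..x, du t)
      = ∫ t in (0 : ℝ)..x, (starRingEnd ℂ) (du t) := by
    intro x
    simp only [intervalIntegral, integral_conj, map_sub]
  have hdu := L2.intervalIntegrable hl.le du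
  have hduc : IntervalIntegrable (fun t => (starRingEnd ℂ) (du t)) volume 0 l :=
    ⟨(RCLike.conjCLE (K := ℂ)).toContinuousLinearMap.integrable_comp hdu.1,
      (RCLike.conjCLE (K := ℂ)).toContinuousLinearMap.integrable_comp hdu.2⟩
  have key := integral_mul_primitive_add_primitive_mul hduc (L2.intervalIntegrable hl.le dv)
    ((starRingEnd ℂ) (f 0)) (g 0)
  rw [← hconj, ← map_add] at key
  have hl1 := hfE (right_mem_Icc.mpr hl.le)
  have hl2 := hgE (right_mem_Icc.mpr hl.le)
  simp only at hl1 hl2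
  rw [← hl1, ← hl2] at key
  rw [← key, ← setIntegral_Ioo_eq_intervalIntegral hl.le, L2.inner_def, L2.inner_def,
    ← integral_add (L2.integrable_inner _ _) (L2.integrable_inner _ _)]
  refine integral_congr_ae ?_
  filter_upwards [hf.2, hg.2, ae_restrict_mem measurableSet_Ioo] with x h1 h2 hx
  have hx1 := hfE (Ioo_subset_Icc_self hx)
  have hx2 := hgE (Ioo_subset_Icc_self hx)
  simp only at hx1 hx2
  rw [RCLike.inner_apply, RCLike.inner_apply, h1, h2, ← hconj, ← map_add, ← hx1, ← hx2]
  ring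

end IntervalCalculus

/-! ### The closed-loop operator -/

namespace EnergySpace

variable {p : BeamParams}

theorem inner_eq_energyForm (X Y : EnergySpace p) : inner ℂ X Y = energyForm X Y := rfl

theorem norm_sq_eq (X : EnergySpace p) : ‖X‖ ^ 2 =
    (1 / 2) * ‖X.z‖ ^ 2 + (1 / 2) * (p.ρ * ‖X.w₁‖ ^ 2 + p.μ * ‖X.w₂‖ ^ 2 + p.α₁ * ‖X.u₁‖ ^ 2
      + p.β * ‖(p.γ : ℂ) • X.u₁ - X.u₂‖ ^ 2) := by
  have h : (inner ℂ X X).re = ‖X‖ ^ 2 := inner_self_eq_norm_sq (𝕜 := ℂ) X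
  rw [← h, inner_eq_energyForm, energyForm_self, Complex.ofReal_re]

theorem sub_z (X Y : EnergySpace p) : (X - Y).z = X.z - Y.z := rfl
theorem sub_u₁ (X Y : EnergySpace p) : (X - Y).u₁ = X.u₁ - Y.u₁ := rfl
theorem sub_u₂ (X Y : EnergySpace p) : (X - Y).u₂ = X.u₂ - Y.u₂ := rfl
theorem sub_w₁ (X Y : EnergySpace p) : (X - Y).w₁ = X.w₁ - Y.w₁ := rfl
theorem sub_w₂ (X Y : EnergySpace p) : (X - Y).w₂ = X.w₂ - Y.w₂ := rfl

/-- Used for the coordinates `z`, `w₁`, `w₂`, `u₁` and `γu₁ - u₂`, each of which is controlled by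
one term of the energy. -/
theorem cauchySeq_of_mul_norm_sq_le {E : Type*} [NormedAddCommGroup E] {f : EnergySpace p → E}
    {c : ℝ} (hc : 0 < c) (hf : ∀ X Y, c * ‖f X - f Y‖ ^ 2 ≤ ‖X - Y‖ ^ 2)
    {s : ℕ → EnergySpace p} (hs : CauchySeq s) : CauchySeq fun n => f (s n) := by
  have hlip : LipschitzWith (Real.toNNReal (√c)⁻¹) f := by
    refine LipschitzWith.of_dist_le_mul fun X Y => ?_
    have h1 : (√c * ‖f X - f Y‖) ^ 2 ≤ ‖X - Y‖ ^ 2 := by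
      rw [mul_pow, Real.sq_sqrt hc.le]
      exact hf X Y
    have h2 := (pow_le_pow_iff_left₀ (by positivity) (norm_nonneg _) two_ne_zero).mp h1
    rw [Real.coe_toNNReal _ (by positivity), dist_eq_norm, dist_eq_norm, inv_mul_eq_div,
      le_div_iff₀ (Real.sqrt_pos.mpr hc), mul_comm]
    exact h2
  exact hlip.uniformContinuous.comp_cauchySeq hs

instance (p : BeamParams) : CompleteSpace (EnergySpace p) := by
  refine Metric.complete_of_cauchySeq_tendsto fun s hs => ?_
  have hρ := p.ρ_pos
  have hμ := p.μ_pos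
  have hα := p.α₁_pos
  have hβ := p.β_pos
  have hnn : ∀ X : EnergySpace p, 0 ≤ ‖X.z‖ ^ 2 ∧ 0 ≤ p.ρ * ‖X.w₁‖ ^ 2 ∧ 0 ≤ p.μ * ‖X.w₂‖ ^ 2 ∧
      0 ≤ p.α₁ * ‖X.u₁‖ ^ 2 ∧ 0 ≤ p.β * ‖(p.γ : ℂ) • X.u₁ - X.u₂‖ ^ 2 := fun X =>
    ⟨by positivity, by positivity, by positivity, by positivity, by positivity⟩
  obtain ⟨z, hz⟩ := cauchySeq_tendsto_of_complete
    (cauchySeq_of_mul_norm_sq_le (f := z) (c := 1 / 2) (by positivity) (fun X Y => by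
      obtain ⟨a1, a2, a3, a4, a5⟩ := hnn (X - Y)
      rw [norm_sq_eq, ← sub_z]; linarith) hs)
  obtain ⟨w₁, hw₁⟩ := cauchySeq_tendsto_of_complete
    (cauchySeq_of_mul_norm_sq_le (f := EnergySpace.w₁) (c := p.ρ / 2) (by positivity)
      (fun X Y => by
        obtain ⟨a1, a2, a3, a4, a5⟩ := hnn (X - Y)
        rw [norm_sq_eq, ← sub_w₁]; linarith) hs)
  obtain ⟨w₂, hw₂⟩ := cauchySeq_tendsto_of_complete
    (cauchySeq_of_mul_norm_sq_le (f := EnergySpace.w₂) (c := p.μ / 2) (by positivity)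
      (fun X Y => by
        obtain ⟨a1, a2, a3, a4, a5⟩ := hnn (X - Y)
        rw [norm_sq_eq, ← sub_w₂]; linarith) hs)
  obtain ⟨u₁, hu₁⟩ := cauchySeq_tendsto_of_complete
    (cauchySeq_of_mul_norm_sq_le (f := EnergySpace.u₁) (c := p.α₁ / 2) (by positivity)
      (fun X Y => by
        obtain ⟨a1, a2, a3, a4, a5⟩ := hnn (X - Y)
        rw [norm_sq_eq, ← sub_u₁]; linarith) hs)
  obtain ⟨v, hv⟩ := cauchySeq_tendsto_of_complete
    (cauchySeq_of_mul_norm_sq_le (f := fun X : EnergySpace p => (p.γ : ℂ) • X.u₁ - X.u₂)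
      (c := p.β / 2) (by positivity) (fun X Y => by
        obtain ⟨a1, a2, a3, a4, a5⟩ := hnn (X - Y)
        have e : (p.γ : ℂ) • X.u₁ - X.u₂ - ((p.γ : ℂ) • Y.u₁ - Y.u₂)
            = (p.γ : ℂ) • (X - Y).u₁ - (X - Y).u₂ := by
          rw [sub_u₁, sub_u₂]; module
        rw [norm_sq_eq, e]; linarith) hs)
  -- The energy controls `u₂` only through `γu₁ - u₂`, whose limit is `v`.
  let L : EnergySpace p := (z, u₁, (p.γ : ℂ) • u₁ - v, w₁, w₂)
  refine ⟨L, ?_⟩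
  rw [tendsto_iff_norm_sub_tendsto_zero]
  have hsq : Tendsto (fun n => ‖s n - L‖ ^ 2) atTop (𝓝 0) := by
    have h1 := (((hz.sub_const z).norm.pow 2).const_mul (1 / 2 : ℝ)).add
      (((((((hw₁.sub_const w₁).norm.pow 2).const_mul p.ρ).add
        (((hw₂.sub_const w₂).norm.pow 2).const_mul p.μ)).add
        (((hu₁.sub_const u₁).norm.pow 2).const_mul p.α₁)).add
        (((hv.sub_const v).norm.pow 2).const_mul p.β)).const_mul (1 / 2 : ℝ))
    simp only [sub_self, norm_zero, ne_eq, OfNat.ofNat_ne_zero, not_false_eq_true, zero_pow,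
      mul_zero, add_zero] at h1
    refine h1.congr fun n => ?_
    have e : (p.γ : ℂ) • (s n - L).u₁ - (s n - L).u₂
        = (p.γ : ℂ) • (s n).u₁ - (s n).u₂ - v := by
      have e1 : L.u₁ = u₁ := rfl
      have e2 : L.u₂ = (p.γ : ℂ) • u₁ - v := rfl
      rw [sub_u₁, sub_u₂, e1, e2]; module
    rw [norm_sq_eq, e]
    rfl
  have h2 := (Real.continuous_sqrt.tendsto 0).comp hsq
  rw [Real.sqrt_zero] at h2
  refine h2.congr fun n => ?_
  exact Real.sqrt_sq (norm_nonneg _)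

end EnergySpace

/-- The energy balance: the closed-loop operator is dissipative. -/
theorem BeamRel.re_inner_nonpos {p : BeamParams} {X Y : EnergySpace p} (h : BeamRel p X Y) :
    (inner ℂ X Y).re ≤ 0 := by
  obtain ⟨dz, ddz, du₁, du₂, dw₁, dw₂, ⟨hz, hdz, hu₁, hu₂, hw₁, hw₂⟩,
    ⟨fz, fdz, fu₁, fu₂, fw₁, fw₂, rz, rdz, ru₁, ru₂, rw₁, rw₂, bc⟩, y1, y2, y3, y4, y5⟩ := h
  obtain ⟨b1, b2, b3, b4, b5, b6⟩ := bc
  have hρ : (p.ρ : ℂ) ≠ 0 := by exact_mod_cast p.ρ_pos.ne'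
  have hμ : (p.μ : ℂ) ≠ 0 := by exact_mod_cast p.μ_pos.ne'
  have k0 := inner_add_inner_weakDeriv p.l₁_pos hz hdz rz rdz
  have k11 := inner_add_inner_weakDeriv p.l₂_pos hw₁ hu₁ rw₁ ru₁
  have k12 := inner_add_inner_weakDeriv p.l₂_pos hw₁ hu₂ rw₁ ru₂
  have k21 := inner_add_inner_weakDeriv p.l₂_pos hw₂ hu₁ rw₂ ru₁
  have k22 := inner_add_inner_weakDeriv p.l₂_pos hw₂ hu₂ rw₂ ru₂
  have hα : (p.α : ℂ) = p.α₁ + p.γ ^ 2 * p.β := by simp [BeamParams.α]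
  -- Energy balance: `⟨X, Y⟩` plus the dissipated power equals a real combination of differences
  -- `⟨a, b⟩ - ⟨b, a⟩`, which are purely imaginary.
  have key : inner ℂ X Y
      + (1 / 2 : ℂ) * (p.κ * inner ℂ dz dz + p.ξ₁ * ((starRingEnd ℂ) (fw₁ p.l₂) * fw₁ p.l₂)
        + p.ξ₂ * ((starRingEnd ℂ) (fw₂ p.l₂) * fw₂ p.l₂))
      = (1 / 2 : ℂ) * (p.α₁ * (inner ℂ X.u₁ dw₁ - inner ℂ dw₁ X.u₁)
        + p.β * (p.γ ^ 2 * (inner ℂ X.u₁ dw₁ - inner ℂ dw₁ X.u₁)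
          - p.γ * (inner ℂ X.u₁ dw₂ - inner ℂ dw₂ X.u₁)
          - p.γ * (inner ℂ X.u₂ dw₁ - inner ℂ dw₁ X.u₂)
          + (inner ℂ X.u₂ dw₂ - inner ℂ dw₂ X.u₂))) := by
    rw [EnergySpace.inner_eq_energyForm, EnergySpace.energyForm, y1, y2, y3, y4, y5]
    simp only [inner_smul_right, inner_smul_left, inner_sub_left, inner_sub_right,
      Complex.conj_ofReal]
    rw [mul_inv_cancel_left₀ hρ, mul_inv_cancel_left₀ hμ]
    rw [b1, ← b2] at k0
    rw [b4] at k21 k22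
    rw [hα] at b3 b5 ⊢
    simp only [map_zero, zero_mul, zero_sub] at k0 k21 k22
    -- The beam identities carry the stress coefficients. `b3` cancels the heat flux against the
    -- stress at the joint, and `b5`, `b6` turn the tip terms into damping.
    linear_combination (1 / 2 : ℂ) * (p.κ * k0 + (p.α₁ + p.γ ^ 2 * p.β) * k11
      - p.γ * p.β * k12 + p.β * k22 - p.γ * p.β * k21
      + (starRingEnd ℂ) (fw₁ p.l₂) * b5 + (starRingEnd ℂ) (fw₂ p.l₂) * b6
      - (starRingEnd ℂ) (fw₁ 0) * b3)
  have hanti : ∀ a b : L2 p.l₂, ∃ r : ℝ, inner ℂ a b - inner ℂ b a = r * Complex.I := by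
    intro a b
    refine ⟨2 * (inner ℂ a b).im, ?_⟩
    rw [← inner_conj_symm b a, Complex.sub_conj]
  obtain ⟨r₁, h1⟩ := hanti X.u₁ dw₁
  obtain ⟨r₂, h2⟩ := hanti X.u₁ dw₂
  obtain ⟨r₃, h3⟩ := hanti X.u₂ dw₁
  obtain ⟨r₄, h4⟩ := hanti X.u₂ dw₂
  have hdz : inner ℂ dz dz = ((‖dz‖ ^ 2 : ℝ) : ℂ) := by
    rw [inner_self_eq_norm_sq_to_K]
    push_cast
    rfl
  rw [h1, h2, h3, h4, hdz, ← Complex.normSq_eq_conj_mul_self,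
    ← Complex.normSq_eq_conj_mul_self] at key
  have e : inner ℂ X Y = (((1 / 2) * (p.α₁ * r₁
      + p.β * (p.γ ^ 2 * r₁ - p.γ * r₂ - p.γ * r₃ + r₄)) : ℝ) : ℂ) * Complex.I - (((1 / 2) * (p.κ * ‖dz‖ ^ 2 + p.ξ₁ * Complex.normSq (fw₁ p.l₂)
        + p.ξ₂ * Complex.normSq (fw₂ p.l₂)) : ℝ) : ℂ) := by
    push_cast at key ⊢
    linear_combination key
  have g1 := p.κ_pos
  have g2 := mul_nonneg p.ξ₁_pos.le (Complex.normSq_nonneg (fw₁ p.l₂))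
  have g3 := mul_nonneg p.ξ₂_pos.le (Complex.normSq_nonneg (fw₂ p.l₂))
  rw [e, Complex.sub_re, Complex.re_ofReal_mul, Complex.I_re, Complex.ofReal_re, mul_zero]
  have g4 : 0 ≤ p.κ * ‖dz‖ ^ 2 := by positivity
  linarith

/-- The offset `q` must not depend on `a` and `b`, because these are determined from it later. -/
theorem exists_second_primitive {l : ℝ} (hl : 0 ≤ l) (g : L2 l) :
    ∃ q : ℂ, ∀ a b : ℂ, ∃ (z dz : L2 l) (f df : ℝ → ℂ), IsWeakDeriv z dz ∧ IsWeakDeriv dz g ∧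
      IsContRep z f ∧ IsContRep dz df ∧ f 0 = a ∧ df 0 = b ∧ f l = a + b * l + q := by
  refine ⟨∫ x in (0 : ℝ)..l, ∫ t in (0 : ℝ)..x, g t, fun a b => ?_⟩
  obtain ⟨dz, hdz, rdz⟩ := exists_isWeakDeriv hl g b
  obtain ⟨z, hz, rz⟩ := exists_isWeakDeriv hl dz a
  refine ⟨z, dz, _, _, hz, hdz, rz, rdz, by simp, by simp, ?_⟩
  have hG : ContinuousOn (fun x => ∫ t in (0 : ℝ)..x, g t) (uIcc 0 l) :=
    ((L2.intervalIntegrable hl g).absolutelyContinuousOnInterval_primitive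
      left_mem_uIcc).continuousOn
  have e : ∫ x in (0 : ℝ)..l, dz x = ∫ x in (0 : ℝ)..l, (b + ∫ t in (0 : ℝ)..x, g t) := by
    rw [← setIntegral_Ioo_eq_intervalIntegral hl, ← setIntegral_Ioo_eq_intervalIntegral hl]
    exact integral_congr_ae rdz.2
  rw [e, intervalIntegral.integral_add intervalIntegrable_const hG.intervalIntegrable,
    intervalIntegral.integral_const, sub_zero, Complex.real_smul]
  ring

/-- The closed-loop operator is surjective. -/
theorem exists_beamRel {p : BeamParams} (Y : EnergySpace p) : ∃ X, BeamRel p X Y := by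
  have hκ : (p.κ : ℂ) ≠ 0 := by exact_mod_cast p.κ_pos.ne'
  have hρ : (p.ρ : ℂ) ≠ 0 := by exact_mod_cast p.ρ_pos.ne'
  have hμ : (p.μ : ℂ) ≠ 0 := by exact_mod_cast p.μ_pos.ne'
  have hα₁ : (p.α₁ : ℂ) ≠ 0 := by exact_mod_cast p.α₁_pos.ne'
  have hβ : (p.β : ℂ) ≠ 0 := by exact_mod_cast p.β_pos.ne'
  have hdet : (p.κ : ℂ) + p.ξ₁ * p.l₁ ≠ 0 := by
    have := p.κ_pos
    have := p.ξ₁_pos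
    have := p.l₁_pos
    exact_mod_cast (by positivity : (0 : ℝ) < p.κ + p.ξ₁ * p.l₁).ne'
  have hα : (p.α : ℂ) = p.α₁ + p.γ ^ 2 * p.β := by simp [BeamParams.α]
  have hl₂ := p.l₂_pos.le
  obtain ⟨q, hq⟩ := exists_second_primitive p.l₁_pos.le ((p.κ : ℂ)⁻¹ • Y.z)
  set m₁ := ∫ t in (0 : ℝ)..p.l₂, Y.u₁ t with hm₁
  set m₂ := ∫ t in (0 : ℝ)..p.l₂, Y.u₂ t with hm₂
  set n₁ := ∫ t in (0 : ℝ)..p.l₂, ((p.ρ : ℂ) • Y.w₁ : L2 p.l₂) t with hn₁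
  set n₂ := ∫ t in (0 : ℝ)..p.l₂, ((p.μ : ℂ) • Y.w₂ : L2 p.l₂) t with hn₂
  -- Here `b = ζ'(0)` and `a = ζ(0) = w₁(0)`. The condition `ζ(l₁) = 0` gives `a = -(b l₁ + q)`, and
  -- strain feedback reads `-κb + n₁ = -ξ₁(a + m₁)`; eliminating `a` leaves this equation.
  obtain ⟨b, hb⟩ : ∃ b : ℂ, b * (p.κ + p.ξ₁ * p.l₁) = n₁ + p.ξ₁ * m₁ - p.ξ₁ * q :=
    ⟨_, div_mul_cancel₀ _ hdet⟩
  obtain ⟨a, ha⟩ : ∃ a : ℂ, a = -(b * p.l₁ + q) := ⟨_, rfl⟩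
  obtain ⟨z, dz, fz, fdz, hz, hdz, rz, rdz, z0, dz0, zl⟩ := hq a b
  obtain ⟨w₁, hw₁, rw₁⟩ := exists_isWeakDeriv hl₂ Y.u₁ a
  obtain ⟨w₂, hw₂, rw₂⟩ := exists_isWeakDeriv hl₂ Y.u₂ 0
  -- `S₁ = αu₁ - γβu₂` and `S₂ = βu₂ - γβu₁`. The initial value of `S₁` comes from the flux
  -- condition at the joint, that of `S₂` from voltage feedback at the tip.
  obtain ⟨S₁, hS₁, rS₁⟩ := exists_isWeakDeriv hl₂ ((p.ρ : ℂ) • Y.w₁) (-(p.κ * b))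
  obtain ⟨S₂, hS₂, rS₂⟩ := exists_isWeakDeriv hl₂ ((p.μ : ℂ) • Y.w₂) (-(p.ξ₂ * m₂) - n₂)
  -- Since `α - γ²β = α₁`, the sum `S₁ + γS₂` equals `α₁u₁`; then `u₂ = S₂/β + γu₁`.
  have hu₁ := (hS₁.add (hS₂.smul (p.γ : ℂ))).smul (p.α₁ : ℂ)⁻¹
  have ru₁ := (rS₁.add (rS₂.smul (p.γ : ℂ))).smul (p.α₁ : ℂ)⁻¹
  have hu₂ := (hS₂.smul (p.β : ℂ)⁻¹).add (hu₁.smul (p.γ : ℂ))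
  have ru₂ := (rS₂.smul (p.β : ℂ)⁻¹).add (ru₁.smul (p.γ : ℂ))
  refine ⟨(z, _, _, w₁, w₂), dz, (p.κ : ℂ)⁻¹ • Y.z, _, _, Y.u₁, Y.u₂,
    ⟨hz, hdz, hu₁, hu₂, hw₁, hw₂⟩, ⟨fz, fdz, _, _, _, _, rz, rdz, ru₁, ru₂, rw₁, rw₂, ?_⟩,
    ?_, rfl, rfl, ?_, ?_⟩
  · constructor
    · rw [zl, ha]; ring
    · simp [z0]
    · simp only [Pi.add_apply, Pi.smul_apply, smul_eq_mul, intervalIntegral.integral_same, dz0, hα]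
      field_simp
      ring
    · simp
    · simp only [Pi.add_apply, Pi.smul_apply, smul_eq_mul, ← hm₁, ← hn₁, ← hn₂, hα]
      field_simp
      linear_combination (-p.α₁ : ℂ) * hb + p.α₁ * p.ξ₁ * ha
    · simp only [Pi.add_apply, Pi.smul_apply, smul_eq_mul, ← hm₂, ← hn₁, ← hn₂]
      field_simp
      ring
  · rw [smul_inv_smul₀ hκ]
  · rw [eq_inv_smul_iff₀ hρ, hα]
    match_scalars <;> field_simp <;> ring
  · rw [eq_inv_smul_iff₀ hμ]
    match_scalars <;> field_simp <;> ring

theorem theorem1 (p : BeamParams) :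
    ∃ T : C0Semigroup (EnergySpace p),
      T.generator = beamOperator p ∧
      ∀ X₀ ∈ (beamOperator p).domain,
        IsClassicalSolution (beamOperator p) X₀ (fun t : ℝ => T.toFun t.toNNReal X₀) ∧
        ∀ X : ℝ → EnergySpace p, IsClassicalSolution (beamOperator p) X₀ X →
          ∀ t : ℝ, 0 ≤ t → X t = T.toFun t.toNNReal X₀ := by
  refine exists_c0Semigroup_generator_eq (fun X => ?_) (fun Y => ?_)
  · exact ((mem_beamOperator_graph p _ _).mp (LinearPMap.mem_graph _ X)).re_inner_nonpos
  · obtain ⟨X, hX⟩ := exists_beamRel Y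
    obtain ⟨X', -, h⟩ := (LinearPMap.mem_graph_iff _).mp ((mem_beamOperator_graph p X Y).mpr hX)
    exact ⟨X', h⟩
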